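/- Let $S=K[x_1,\dots,x_n]$ be the standard graded polynomial ring over a field $K$. Definitions. For an ideal $I\subseteq S$, its $k$th symbolic power is $I^{(k)}=\bigcap_{P\in\mathrm{Ass}(S/I)}(I^kS_P\cap S)$. For a non-empty set $A\subseteq\{1,\dots,n\}$ put $P_A=(x_i : i\in A)$, and for $d\ge 1$ let $I_{A,d}$ be the squarefree Veronese ideal generated by all squarefree monomials of degree $d$ in the variables $x_i$, $i\in A$ (so $I_{A,d}=0$ if $d>|A|$). For a monomial ideal $J$, let $G(J)$ be its set of minimal monomial generators, let its support be the set of all $i$ such that $x_i$ divides some element of $G(J)$, and let $J^{\le\mathbf 1}$ be the ideal generated by all squarefree monomials in $J$. An ideal $I\subseteq S$ is a *matching-matroidal ideal of Veronese type* if $I=(P_{A_1}\cdots P_{A_t})^{\le\mathbf 1}$ for non-empty sets $A_1,\dots,A_t\subseteq\{1,\dots,n\}$ such that $A_i=A_j$ whenever $A_i\cap A_j\neq\emptyset$. A monomial ideal $J$ has *linear quotients* if $G(J)$ can be ordered as $u_1,\dots,u_m$ such that, for every $i$, the colon ideal $(u_1,\dots,u_{i-1}):(u_i)$ is generated by variables.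 Finally, $\mathrm{reg}\,J=\max\{j-i : \mathrm{Tor}_i^S(K,J)_j\neq 0\}$ is the Castelnuovo–Mumford regularity of a homogeneous ideal $J$ (with $\mathrm{reg}\,0=-\infty$). Theorem. An ideal $I\subseteq S$ is a matching-matroidal ideal of Veronese type if and only if it is a product $I_{B_1,d_1}\cdots I_{B_m,d_m}$ of squarefree Veronese ideals, with $B_i\ne\emptyset$ and $d_i\ge1$, whose supports are pairwise disjoint. If $I$ is such an ideal, then for every $k\ge 1$ the symbolic power $I^{(k)}$ is a monomial ideal with linear quotients, and $\mathrm{reg}\,I^{(k)}=\mathrm{reg}\,I^k$. -/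

import Mathlib

noncomputable section

namespace SymbolicPowers

open MvPolynomial

/-- The `k`-th symbolic power `I^(k) = ⋂_{P ∈ Ass(R/I)} (I^k R_P ∩ R)`, the intersection running over
all associated primes of `I`, embedded ones included. -/
def symbolicPower {R : Type*} [CommRing R] (I : Ideal R) (k : ℕ) : Ideal R :=
  ⨅ P : associatedPrimes R (R ⧸ I),
    haveI : P.1.IsPrime := P.2.1
    Ideal.comap (algebraMap R (Localization.AtPrime P.1))
      (Ideal.map (algebraMap R (Localization.AtPrime P.1)) (I ^ k))

variable {K : Type*} [Field K] {n : ℕ}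

/-- The ideal generated by the monomials `x^a`, `a ∈ A`. -/
def monomialSpan (A : Set (Fin n →₀ ℕ)) : Ideal (MvPolynomial (Fin n) K) :=
  Ideal.span ((fun a => monomial a (1 : K)) '' A)

/-- `I` is a monomial ideal. -/
def IsMonomialIdeal (I : Ideal (MvPolynomial (Fin n) K)) : Prop :=
  ∃ A : Set (Fin n →₀ ℕ), I = monomialSpan A

/-- The exponent vectors of the elements of `G(I)`, the minimal monomial generators of a monomial
ideal `I`: the monomials of `I` that are minimal with respect to divisibility. -/
def minGens (I : Ideal (MvPolynomial (Fin n) K)) : Set (Fin n →₀ ℕ) :=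
  {a | Minimal (fun b : Fin n →₀ ℕ => monomial b (1 : K) ∈ I) a}

/-- The support of a monomial ideal: the union of the supports of its minimal monomial
generators. -/
def idealSupport (I : Ideal (MvPolynomial (Fin n) K)) : Set (Fin n) :=
  ⋃ a ∈ minGens I, (a.support : Set (Fin n))

/-- `I` is a monomial ideal with linear quotients: `G(I)` can be ordered as `u_1, …, u_m` such that
each colon ideal `(u_1, …, u_{i-1}) : (u_i)` is generated by variables. -/
def HasLinearQuotients (I : Ideal (MvPolynomial (Fin n) K)) : Prop :=
  IsMonomialIdeal I ∧
    ∃ (m : ℕ) (u : Fin m → (Fin n →₀ ℕ)), Function.Injective u ∧ Set.range u = minGens I ∧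
      ∀ i : Fin m, ∃ T : Set (Fin n),
        Submodule.colon (monomialSpan (u '' {j | j < i}) : Ideal (MvPolynomial (Fin n) K))
            {monomial (u i) (1 : K)} =
          Ideal.span (X '' T)

/-- The differential of the Koszul complex of `x_1, …, x_n` on `S`, where a chain `∑_F c_F e_F` is
stored as its family of coefficients and
`∂ e_F = ∑_{p ∈ F} (-1)^{#{q ∈ F : q < p}} x_p e_{F \ {p}}`. -/
def koszulDifferential (K : Type*) [Field K] (n : ℕ) :
    (Finset (Fin n) → MvPolynomial (Fin n) K) →ₗ[K]
      (Finset (Fin n) → MvPolynomial (Fin n) K) where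
  toFun c G := ∑ p ∈ Gᶜ, (-1) ^ (G.filter (· < p)).card * (X p * c (insert p G))
  map_add' c c' := by
    funext G
    simp [mul_add, Finset.sum_add_distrib]
  map_smul' r c := by
    funext G
    simp [Finset.smul_sum]

/-- The chains of homological degree `i` of the Koszul complex `K_•(x_1, …, x_n; I)`: the
coefficients lie in `I`. -/
def koszulChains (I : Ideal (MvPolynomial (Fin n) K)) (i : ℕ) :
    Submodule K (Finset (Fin n) → MvPolynomial (Fin n) K) where
  carrier := {c | (∀ F, c F ∈ I) ∧ ∀ F, F.card ≠ i → c F = 0}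
  add_mem' := by
    rintro c c' ⟨h₁, h₂⟩ ⟨h₃, h₄⟩
    exact ⟨fun F => I.add_mem (h₁ F) (h₃ F), fun F hF => by simp [h₂ F hF, h₄ F hF]⟩
  zero_mem' := ⟨fun _ => I.zero_mem, fun _ _ => rfl⟩
  smul_mem' := by
    rintro r c ⟨h₁, h₂⟩
    refine ⟨fun F => ?_, fun F hF => by simp [h₂ F hF]⟩
    rw [Pi.smul_apply, smul_eq_C_mul]
    exact I.mul_mem_left _ (h₁ F)

/-- The chains all of whose coefficients are homogeneous of degree `d`. As `e_F` has degree `#F`,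
inside homological degree `i` these are the chains of internal degree `i + d`. -/
def koszulStrand (K : Type*) [Field K] (n d : ℕ) :
    Submodule K (Finset (Fin n) → MvPolynomial (Fin n) K) :=
  Submodule.pi Set.univ fun _ => homogeneousSubmodule (Fin n) K d

/-- The cycles of homological degree `i` and internal degree `i + d`. -/
def koszulCycles (I : Ideal (MvPolynomial (Fin n) K)) (i d : ℕ) :
    Submodule K (Finset (Fin n) → MvPolynomial (Fin n) K) :=
  koszulChains I i ⊓ koszulStrand K n d ⊓ LinearMap.ker (koszulDifferential K n)

/-- The boundaries of homological degree `i` and internal degree `i + d`. -/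
def koszulBoundaries (I : Ideal (MvPolynomial (Fin n) K)) (i d : ℕ) :
    Submodule K (Finset (Fin n) → MvPolynomial (Fin n) K) :=
  koszulStrand K n d ⊓ (koszulChains I (i + 1)).map (koszulDifferential K n)

/-- The graded component `H_i(x_1, …, x_n; I)_{i + d} ≅ Tor_i^S(K, I)_{i + d}` of Koszul homology,
where `S = K[x_1, …, x_n]` has the standard grading. Its `K`-dimension is the graded Betti number
`β_{i, i + d}(I)`, that is, the number of summands `S(-(i + d))` in homological degree `i` of the
minimal graded free resolution of `I`. -/
abbrev KoszulHomology (I : Ideal (MvPolynomial (Fin n) K)) (i d : ℕ) : Type _ :=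
  koszulCycles I i d ⧸ (koszulBoundaries I i d).submoduleOf (koszulCycles I i d)

/-- The Castelnuovo–Mumford regularity `reg I = max {j - i : β_{i, j}(I) ≠ 0}` of a homogeneous
ideal `I` of the standard graded polynomial ring `K[x_1, …, x_n]`; here `j = i + d`, as
`β_{i, j}(I) = 0` for `j < i`. The zero ideal has regularity `-∞`. -/
def regularity (I : Ideal (MvPolynomial (Fin n) K)) : WithBot ℕ∞ :=
  ⨆ (i : ℕ) (d : ℕ) (_ : Nontrivial (KoszulHomology I i d)), ((d : ℕ∞) : WithBot ℕ∞)

/-- The monomial prime ideal `P_A = (x_i : i ∈ A)`. -/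
def monomialPrime (K : Type*) [Field K] (A : Finset (Fin n)) :
    Ideal (MvPolynomial (Fin n) K) :=
  Ideal.span (X '' (A : Set (Fin n)))

/-- The squarefree part of a monomial ideal `I`: the ideal generated by all the monomials `x^b ∈ I`
with `b_i ≤ 1` for all `i`. -/
def squarefreePart (I : Ideal (MvPolynomial (Fin n) K)) : Ideal (MvPolynomial (Fin n) K) :=
  monomialSpan {b : Fin n →₀ ℕ | monomial b (1 : K) ∈ I ∧ ∀ i, b i ≤ 1}

/-- `I = (P_{A_1} ⋯ P_{A_t})^{≤ (1, …, 1)}` for non-empty sets `A_1, …, A_t` of variables such that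
`A_i = A_j` whenever `A_i` and `A_j` meet. -/
def IsMatchingMatroidalOfVeroneseType (I : Ideal (MvPolynomial (Fin n) K)) : Prop :=
  ∃ (t : ℕ) (A : Fin t → Finset (Fin n)),
    (∀ i, (A i).Nonempty) ∧ (∀ i j, (A i ∩ A j).Nonempty → A i = A j) ∧
      I = squarefreePart (∏ i, monomialPrime K (A i))

/-- The squarefree Veronese ideal `I_{B,d}`, generated by all the squarefree monomials of degree `d`
in the variables `x_i`, `i ∈ B`. -/
def squarefreeVeronese (K : Type*) [Field K] (B : Finset (Fin n)) (d : ℕ) :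
    Ideal (MvPolynomial (Fin n) K) :=
  Ideal.span {f | ∃ F : Finset (Fin n), F ⊆ B ∧ F.card = d ∧ f = ∏ i ∈ F, X i}

/-- `I` is a product of squarefree Veronese ideals with pairwise disjoint supports. -/
def IsProductOfSquarefreeVeronese (I : Ideal (MvPolynomial (Fin n) K)) : Prop :=
  ∃ (m : ℕ) (B : Fin m → Finset (Fin n)) (d : Fin m → ℕ),
    (∀ i, (B i).Nonempty) ∧ (∀ i, 0 < d i) ∧
      (∀ i j, i ≠ j → Disjoint (idealSupport (squarefreeVeronese K (B i) (d i)))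
        (idealSupport (squarefreeVeronese K (B j) (d j)))) ∧
      I = ∏ i, squarefreeVeronese K (B i) (d i)

end SymbolicPowers

end

/-! Everything reduces to one combinatorial model: disjoint blocks `B i` with multiplicities `d i`,
and `I` spanned by the exponents in `meetSet B d`. Both descriptions of `I` lead there. Repeating a
block `d i` times in a product of primes and keeping squarefree monomials asks for `d i` distinct
variables of that block, as does a Veronese factor. If some `d i` exceeds the block size, then `I =
0`, and this case is treated apart.

Otherwise `I` is the irredundant intersection of the primes `P_F`, where `F` runs over the subsets
of a block `B i` with `|B i| - d i + 1` elements. Powers of `P_F` are `P_F`-primary, so `I^(k)`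
consists of the exponents whose sum over each such `F` is at least `k`
(`symbolicPower_inf_monomialPrime`). Its minimal elements can be found block by block: the maximum
`M` is attained at least `d` times and the total is `k + (d - 1) M` (`exists_isBlockGen_le`,
`IsBlockGen.eq_of_le`). The generators of `I^k` are the exponents bounded by `k` with block totals
`k * d i` (`monomialSpan_meetSet_pow`).

Linear quotients follow from an exchange property. For `I^k` the lexicographic order works
(`powerGens_exchange`). For `I^(k)` the generators have different degrees, and the order compares
first the sum of the block maxima, then the sum of squares, then lexicographically
(`symbolicGens_exchange`).

Adding generators one at a time, with successive quotients `S / P_T` up to a shift, shows that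
Koszul homology vanishes beyond the largest generator degree (`exists_koszulDifferential_eq`). A
minimal generator of that degree is visible in `H_0`. Both ideals have largest generator degree `∑
i, k * d i`, reached by a common generator (`exists_mem_inter_gens`), so the regularities agree. -/

noncomputable section

namespace SymbolicPowers

open MvPolynomial

/-! ### Products of squarefree Veronese ideals and matching-matroidal ideals as spans of exponent
sets -/

section MonomialSpan

variable {K : Type*} [Field K] {n : ℕ}

theorem mem_monomialSpan {A : Set (Fin n →₀ ℕ)} {f : MvPolynomial (Fin n) K} :
    f ∈ monomialSpan A ↔ ∀ m ∈ f.support, ∃ a ∈ A, a ≤ m :=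
  mem_ideal_span_monomial_image

theorem monomial_mem_monomialSpan {A : Set (Fin n →₀ ℕ)} {b : Fin n →₀ ℕ} {c : K} (hc : c ≠ 0) :
    monomial b c ∈ (monomialSpan A : Ideal (MvPolynomial (Fin n) K)) ↔ ∃ a ∈ A, a ≤ b := by
  classical
  rw [mem_monomialSpan, support_monomial, if_neg hc]
  simp

theorem monomialSpan_le_iff {A : Set (Fin n →₀ ℕ)} {J : Ideal (MvPolynomial (Fin n) K)} :
    monomialSpan A ≤ J ↔ ∀ a ∈ A, monomial a (1 : K) ∈ J := by
  rw [monomialSpan, Ideal.span_le, Set.image_subset_iff]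
  rfl

theorem monomialSpan_eq_of_forall {A A' : Set (Fin n →₀ ℕ)} (h : ∀ a ∈ A, ∃ b ∈ A', b ≤ a)
    (h' : ∀ a ∈ A', ∃ b ∈ A, b ≤ a) :
    (monomialSpan A : Ideal (MvPolynomial (Fin n) K)) = monomialSpan A' := by
  apply le_antisymm <;> rw [monomialSpan_le_iff] <;> intro a ha <;>
    rw [monomial_mem_monomialSpan one_ne_zero]
  exacts [h a ha, h' a ha]

theorem mem_monomialSpan_of_isUpperSet {A : Set (Fin n →₀ ℕ)} (hA : IsUpperSet A)
    {f : MvPolynomial (Fin n) K} : f ∈ monomialSpan A ↔ ∀ m ∈ f.support, m ∈ A := by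
  rw [mem_monomialSpan]
  exact ⟨fun h m hm => let ⟨_, ha, hle⟩ := h m hm; hA hle ha, fun h m hm => ⟨m, h m hm, le_rfl⟩⟩

theorem prod_X_eq_monomial (F : Finset (Fin n)) :
    (∏ i ∈ F, X i : MvPolynomial (Fin n) K) = monomial (∑ i ∈ F, Finsupp.single i 1) 1 := by
  rw [monomial_sum_one]
  rfl

theorem sum_single_one_apply (F : Finset (Fin n)) (p : Fin n) :
    (∑ i ∈ F, Finsupp.single i 1 : Fin n →₀ ℕ) p = if p ∈ F then 1 else 0 := by
  rw [Finsupp.finsetSum_apply]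
  simp [Finsupp.single_apply]

/-- The exponents whose support meets each `B i` in at least `d i` elements. -/
def meetSet {ι : Type*} (B : ι → Finset (Fin n)) (d : ι → ℕ) : Set (Fin n →₀ ℕ) :=
  {a | ∀ i, d i ≤ ((B i).filter fun p => a p ≠ 0).card}

theorem isUpperSet_meetSet {ι : Type*} (B : ι → Finset (Fin n)) (d : ι → ℕ) :
    IsUpperSet (meetSet B d) := by
  intro a b hab ha i
  refine (ha i).trans (Finset.card_le_card fun p hp => ?_)
  rw [Finset.mem_filter] at hp ⊢
  refine ⟨hp.1, fun h => hp.2 ?_⟩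
  have := hab p
  omega

theorem squarefreeVeronese_eq_monomialSpan (B : Finset (Fin n)) (d : ℕ) :
    squarefreeVeronese K B d =
      monomialSpan {a | ∃ F ⊆ B, F.card = d ∧ a = ∑ i ∈ F, Finsupp.single i 1} := by
  unfold squarefreeVeronese monomialSpan
  congr 1
  ext f
  simp only [Set.mem_ofPred_eq, Set.mem_image]
  constructor
  · rintro ⟨F, hF, hd, rfl⟩
    exact ⟨_, ⟨F, hF, hd, rfl⟩, (prod_X_eq_monomial F).symm⟩
  · rintro ⟨_, ⟨F, hF, hd, rfl⟩, rfl⟩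
    exact ⟨F, hF, hd, (prod_X_eq_monomial F).symm⟩

theorem squarefreeVeronese_le (B : Finset (Fin n)) (d : ℕ) :
    squarefreeVeronese K B d ≤ monomialSpan {a | d ≤ (B.filter fun p => a p ≠ 0).card} := by
  rw [squarefreeVeronese_eq_monomialSpan, monomialSpan_le_iff]
  rintro _ ⟨F, hF, rfl, rfl⟩
  rw [monomial_mem_monomialSpan one_ne_zero]
  refine ⟨_, Finset.card_le_card fun p hp => ?_, le_rfl⟩
  rw [Finset.mem_filter, sum_single_one_apply, if_pos hp]
  exact ⟨hF hp, one_ne_zero⟩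

theorem idealSupport_squarefreeVeronese_subset (B : Finset (Fin n)) (d : ℕ) :
    idealSupport (squarefreeVeronese K B d) ⊆ B := by
  intro p hp
  rw [idealSupport, Set.mem_iUnion₂] at hp
  obtain ⟨a, ha, hpa⟩ := hp
  rw [minGens, Set.mem_ofPred_eq, squarefreeVeronese_eq_monomialSpan] at ha
  obtain ⟨b, ⟨F, hF, hd, rfl⟩, hb⟩ := (monomial_mem_monomialSpan one_ne_zero).1 ha.prop
  have := ha.le_of_le (y := _) ((monomial_mem_monomialSpan one_ne_zero).2
    ⟨_, ⟨F, hF, hd, rfl⟩, le_rfl⟩) hb p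
  rw [sum_single_one_apply] at this
  rw [Finset.mem_coe, Finsupp.mem_support_iff] at hpa
  by_cases h : p ∈ F
  · exact hF h
  · rw [if_neg h] at this
    omega

/-- Any variable of the block extends to a `d`-subset, and all generators have the same degree,
hence are minimal. This turns disjointness of supports into disjointness of blocks. -/
theorem subset_idealSupport_squarefreeVeronese {B : Finset (Fin n)} {d : ℕ} (hd : 0 < d)
    (hB : d ≤ B.card) : (B : Set (Fin n)) ⊆ idealSupport (squarefreeVeronese K B d) := by
  intro p hp
  obtain ⟨F, hpF, hF, hFd⟩ := Finset.exists_subsuperset_card_eq (s := {p}) (t := B)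
    (Finset.singleton_subset_iff.2 hp) (n := d) (by simpa using Nat.succ_le_of_lt hd) hB
  rw [idealSupport, Set.mem_iUnion₂]
  refine ⟨∑ i ∈ F, Finsupp.single i 1, ⟨?_, ?_⟩, ?_⟩
  · rw [squarefreeVeronese_eq_monomialSpan]
    exact (monomial_mem_monomialSpan one_ne_zero).2 ⟨_, ⟨F, hF, hFd, rfl⟩, le_rfl⟩
  · intro b hb hle
    rw [squarefreeVeronese_eq_monomialSpan] at hb
    obtain ⟨_, ⟨F', hF', hFd', rfl⟩, hb⟩ := (monomial_mem_monomialSpan one_ne_zero).1 hb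
    have : F' ⊆ F := fun q hq => by
      have := (hb.trans hle) q
      rw [sum_single_one_apply, sum_single_one_apply, if_pos hq] at this
      by_contra h
      rw [if_neg h] at this
      omega
    rw [Finset.eq_of_subset_of_card_le this (by omega)] at hb
    exact hb
  · rw [Finset.mem_coe, Finsupp.mem_support_iff, sum_single_one_apply,
      if_pos (hpF (Finset.mem_singleton_self p))]
    exact one_ne_zero

/-- A product lies in each of its factors. Conversely, squarefree monomials chosen in disjoint
blocks are coprime, so if each divides `x^a`, their product does too. -/
theorem prod_squarefreeVeronese_eq {ι : Type*} [Fintype ι] (B : ι → Finset (Fin n)) (d : ι → ℕ)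
    (hB : Pairwise fun i j => Disjoint (B i) (B j)) :
    ∏ i, squarefreeVeronese K (B i) (d i) = monomialSpan (meetSet B d) := by
  apply le_antisymm
  · intro f hf
    rw [mem_monomialSpan_of_isUpperSet (isUpperSet_meetSet B d)]
    intro m hm i
    have hfi := squarefreeVeronese_le (B i) (d i)
      ((Ideal.prod_le_inf.trans (Finset.inf_le (Finset.mem_univ i))) hf)
    obtain ⟨a, ha, ham⟩ := mem_monomialSpan.1 hfi m hm
    refine le_trans ha (Finset.card_le_card fun p hp => ?_)
    rw [Finset.mem_filter] at hp ⊢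
    have := ham p
    exact ⟨hp.1, by omega⟩
  · rw [monomialSpan_le_iff]
    intro a ha
    choose F hF hFd using fun i => Finset.exists_subset_card_eq (ha i)
    have hsum : ∑ i, ∑ p ∈ F i, Finsupp.single p 1 ≤ a := by
      classical
      rw [← Finset.sum_biUnion]
      · intro p
        rw [sum_single_one_apply]
        split_ifs with h
        · obtain ⟨i, -, hi⟩ := Finset.mem_biUnion.1 h
          exact Nat.one_le_iff_ne_zero.2 (Finset.mem_filter.1 (hF i hi)).2
        · exact Nat.zero_le _
      · intro i _ j _ hij
        exact Finset.disjoint_of_subset_left ((hF i).trans (Finset.filter_subset _ _))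
          (Finset.disjoint_of_subset_right ((hF j).trans (Finset.filter_subset _ _)) (hB hij))
    have hmem : monomial (∑ i, ∑ p ∈ F i, Finsupp.single p 1) (1 : K) ∈
        ∏ i, squarefreeVeronese K (B i) (d i) := by
      rw [monomial_sum_one]
      refine Ideal.prod_mem_prod fun i _ => ?_
      rw [← prod_X_eq_monomial]
      exact Ideal.subset_span ⟨F i, (hF i).trans (Finset.filter_subset _ _), hFd i, rfl⟩
    rw [← add_tsub_cancel_of_le hsum, ← one_mul (1 : K), ← monomial_mul]
    exact Ideal.mul_mem_right _ _ hmem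

theorem monomialSpan_empty : (monomialSpan ∅ : Ideal (MvPolynomial (Fin n) K)) = ⊥ := by
  simp [monomialSpan]

theorem meetSet_eq_empty {ι : Type*} {B : ι → Finset (Fin n)} {d : ι → ℕ} {i : ι}
    (h : (B i).card < d i) : meetSet B d = ∅ := by
  refine Set.eq_empty_of_forall_notMem fun a ha => ?_
  have := (ha i).trans (Finset.card_filter_le _ _)
  omega

theorem prod_monomialPrime_eq {τ : Type*} [Fintype τ] (A : τ → Finset (Fin n)) :
    ∏ j, monomialPrime K (A j) =
      monomialSpan {a | ∃ c : τ → Fin n, (∀ j, c j ∈ A j) ∧ a = ∑ j, Finsupp.single (c j) 1} := by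
  classical
  unfold monomialPrime monomialSpan
  rw [Ideal.prod_span]
  congr 1
  ext f
  rw [Set.mem_finsetProd]
  constructor
  · rintro ⟨g, hg, rfl⟩
    choose c hc hcg using fun j => hg (i := j) (Finset.mem_univ j)
    refine ⟨_, ⟨c, hc, rfl⟩, ?_⟩
    simp only [monomial_sum_one]
    exact Finset.prod_congr rfl fun j _ => hcg j
  · rintro ⟨_, ⟨c, hc, rfl⟩, rfl⟩
    refine ⟨fun j => X (c j), fun {j} _ => ⟨c j, hc j, rfl⟩, ?_⟩
    simp only [monomial_sum_one]
    rfl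

/-- A squarefree element of the product amounts to a system of distinct representatives for the sets
`B (σ j)`. As these sets are equal or disjoint, such a system exists exactly when each block has
enough elements for the indices that `σ` sends to it. -/
theorem squarefreePart_prod_eq {ι τ : Type*} [Fintype τ] [DecidableEq ι]
    (B : ι → Finset (Fin n)) (hB : Pairwise fun i j => Disjoint (B i) (B j)) (σ : τ → ι) :
    squarefreePart (∏ j, monomialPrime K (B (σ j))) =
      monomialSpan (meetSet B fun i => (Finset.univ.filter fun j => σ j = i).card) := by
  classical
  rw [squarefreePart]
  apply monomialSpan_eq_of_forall
  · rintro b ⟨hb, hb1⟩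
    rw [prod_monomialPrime_eq, monomial_mem_monomialSpan one_ne_zero] at hb
    obtain ⟨_, ⟨c, hc, rfl⟩, hle⟩ := hb
    refine ⟨b, fun i => ?_, le_rfl⟩
    have hpos : ∀ j, 1 ≤ b (c j) := fun j => by
      refine le_trans ?_ (hle (c j))
      rw [Finsupp.finsetSum_apply]
      refine le_trans ?_ (Finset.single_le_sum (fun _ _ => Nat.zero_le _) (Finset.mem_univ j))
      simp
    have hinj : Function.Injective c := by
      intro j j' hj
      by_contra hne
      have h2 : 2 ≤ (∑ j, Finsupp.single (c j) 1 : Fin n →₀ ℕ) (c j) := by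
        rw [Finsupp.finsetSum_apply]
        refine le_trans ?_ (Finset.sum_le_sum_of_subset (Finset.subset_univ {j, j'}))
        rw [Finset.sum_pair hne, hj]
        simp
      have := hb1 (c j)
      have := hle (c j)
      omega
    refine Finset.card_le_card_of_injOn c (fun j hj => ?_) hinj.injOn
    rw [Finset.mem_coe, Finset.mem_filter] at hj ⊢
    exact ⟨hj.2 ▸ hc j, Nat.one_le_iff_ne_zero.1 (hpos j)⟩
  · intro a ha
    have hemb : ∀ i, ∃ f : {j // σ j = i} → Fin n, Function.Injective f ∧
        ∀ j, f j ∈ (B i).filter fun p => a p ≠ 0 := fun i => by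
      have hcard : Fintype.card {j // σ j = i} ≤
          Fintype.card ((B i).filter fun p => a p ≠ 0 : Finset (Fin n)) := by
        rw [Fintype.card_subtype, Fintype.card_coe]
        exact ha i
      obtain ⟨f⟩ := Function.Embedding.nonempty_of_card_le hcard
      exact ⟨fun j => (f j).1, fun x y h => f.injective (Subtype.ext h), fun j => (f j).2⟩
    choose f hf hfa using hemb
    let c : τ → Fin n := fun j => f (σ j) ⟨j, rfl⟩
    have hc : ∀ j, c j ∈ B (σ j) ∧ a (c j) ≠ 0 := fun j => Finset.mem_filter.1 (hfa _ _)
    have hinj : Function.Injective c := by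
      intro j j' hj
      have hσ : σ j = σ j' := by
        by_contra hne
        exact Finset.disjoint_left.1 (hB hne) (hc j).1 (hj ▸ (hc j').1)
      have hf' : ∀ i (h : σ j' = i), c j' = f i ⟨j', h⟩ := by
        rintro i rfl
        rfl
      exact congrArg Subtype.val (hf (σ j) (hj.trans (hf' _ hσ.symm)))
    have hsum : (∑ j, Finsupp.single (c j) 1 : Fin n →₀ ℕ) =
        ∑ p ∈ Finset.univ.image c, Finsupp.single p 1 := by
      rw [Finset.sum_image fun _ _ _ _ h => hinj h]
    refine ⟨∑ j, Finsupp.single (c j) 1, ⟨?_, ?_⟩, ?_⟩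
    · rw [prod_monomialPrime_eq, monomial_mem_monomialSpan one_ne_zero]
      exact ⟨_, ⟨c, fun j => (hc j).1, rfl⟩, le_rfl⟩
    · intro p
      rw [hsum, sum_single_one_apply]
      split_ifs <;> simp
    · intro p
      rw [hsum, sum_single_one_apply]
      split_ifs with h
      · obtain ⟨j, -, rfl⟩ := Finset.mem_image.1 h
        exact Nat.one_le_iff_ne_zero.2 (hc j).2
      · exact Nat.zero_le _

/-- A matching-matroidal ideal of Veronese type is given by disjoint blocks with multiplicities. -/
theorem IsMatchingMatroidalOfVeroneseType.exists_meetSet {I : Ideal (MvPolynomial (Fin n) K)}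
    (h : IsMatchingMatroidalOfVeroneseType I) :
    ∃ (m : ℕ) (B : Fin m → Finset (Fin n)) (d : Fin m → ℕ), (∀ i, (B i).Nonempty) ∧
      (∀ i, 0 < d i) ∧ (Pairwise fun i j => Disjoint (B i) (B j)) ∧
        I = monomialSpan (meetSet B d) := by
  classical
  obtain ⟨t, A, hne, hA, rfl⟩ := h
  let e := (Finset.univ.image A).equivFin
  let B : Fin (Finset.univ.image A).card → Finset (Fin n) := fun i => (e.symm i).1
  let σ : Fin t → Fin (Finset.univ.image A).card :=
    fun j => e ⟨A j, Finset.mem_image_of_mem A (Finset.mem_univ j)⟩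
  have hσ : ∀ j, B (σ j) = A j := fun j => by simp [B, σ]
  have hsurj : ∀ i, ∃ j, σ j = i := fun i => by
    obtain ⟨j, -, hj⟩ := Finset.mem_image.1 (e.symm i).2
    refine ⟨j, e.symm.injective ?_⟩
    simp [σ, hj]
  have hB : Pairwise fun i j => Disjoint (B i) (B j) := by
    intro i j hij
    obtain ⟨i, rfl⟩ := hsurj i
    obtain ⟨j, rfl⟩ := hsurj j
    rw [hσ, hσ]
    by_contra hd
    rw [Finset.disjoint_iff_inter_eq_empty, ← ne_eq, ← Finset.nonempty_iff_ne_empty] at hd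
    exact hij (by simp only [σ, hA i j hd])
  refine ⟨_, B, fun i => (Finset.univ.filter fun j => σ j = i).card, fun i => ?_, fun i => ?_,
    hB, ?_⟩
  · obtain ⟨i, rfl⟩ := hsurj i
    exact hσ i ▸ hne i
  · obtain ⟨j, hj⟩ := hsurj i
    exact Finset.card_pos.2 ⟨j, by simpa using hj⟩
  · rw [← squarefreePart_prod_eq B hB σ]
    simp only [hσ]

theorem isMatchingMatroidalOfVeroneseType_monomialSpan_meetSet {m : ℕ}
    {B : Fin m → Finset (Fin n)} {d : Fin m → ℕ} (hne : ∀ i, (B i).Nonempty)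
    (hB : Pairwise fun i j => Disjoint (B i) (B j)) :
    IsMatchingMatroidalOfVeroneseType
      (monomialSpan (meetSet B d) : Ideal (MvPolynomial (Fin n) K)) := by
  let σ : Fin (∑ i, d i) → Fin m := fun j => (finSigmaFinEquiv.symm j).1
  have hσ : ∀ i, (Finset.univ.filter fun j => σ j = i).card = d i := fun i => by
    rw [← Fintype.card_subtype, ← Fintype.card_fin (d i)]
    refine Fintype.card_congr ((Equiv.subtypeEquiv (p := fun j => σ j = i)
      (q := fun x : (i : Fin m) × Fin (d i) => x.1 = i) finSigmaFinEquiv.symm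
      fun j => Iff.rfl).trans (Equiv.sigmaSubtype i))
  refine ⟨_, fun j => B (σ j), fun j => hne _, fun i j hij => ?_, ?_⟩
  · by_contra h
    have : Disjoint (B (σ i)) (B (σ j)) := hB (fun h' : σ i = σ j => h (congrArg B h'))
    rw [Finset.disjoint_iff_inter_eq_empty] at this
    exact hij.ne_empty this
  · rw [squarefreePart_prod_eq B hB σ]
    simp only [hσ]

theorem isMatchingMatroidalOfVeroneseType_iff (I : Ideal (MvPolynomial (Fin n) K)) :
    IsMatchingMatroidalOfVeroneseType I ↔ IsProductOfSquarefreeVeronese I := by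
  constructor
  · intro h
    obtain ⟨m, B, d, hne, hd, hB, rfl⟩ := h.exists_meetSet
    refine ⟨m, B, d, hne, hd, fun i j hij => ?_, (prod_squarefreeVeronese_eq B d hB).symm⟩
    exact Set.disjoint_of_subset (idealSupport_squarefreeVeronese_subset _ _)
      (idealSupport_squarefreeVeronese_subset _ _) (Finset.disjoint_coe.2 (hB hij))
  · rintro ⟨m, B, d, hne, hd, hB, rfl⟩
    by_cases hcard : ∀ i, d i ≤ (B i).card
    · have hB' : Pairwise fun i j => Disjoint (B i) (B j) := fun i j hij =>
        Finset.disjoint_coe.1 (Set.disjoint_of_subset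
          (subset_idealSupport_squarefreeVeronese (hd i) (hcard i))
          (subset_idealSupport_squarefreeVeronese (hd j) (hcard j)) (hB i j hij))
      rw [prod_squarefreeVeronese_eq B d hB']
      exact isMatchingMatroidalOfVeroneseType_monomialSpan_meetSet hne hB'
    -- A zero factor has empty support, so nothing is known here about the disjointness of the
    -- blocks. But the product is zero, and a single block with too large a multiplicity represents
    -- the zero ideal.
    · push Not at hcard
      obtain ⟨i, hi⟩ := hcard
      have hzero : ∏ i, squarefreeVeronese K (B i) (d i) = ⊥ := by
        rw [← le_bot_iff]
        refine (Ideal.prod_le_inf.trans (Finset.inf_le (Finset.mem_univ i))).trans ?_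
        refine (squarefreeVeronese_le (B i) (d i)).trans ?_
        rw [← monomialSpan_empty, monomialSpan_le_iff]
        intro a ha
        have := le_trans ha (Finset.card_filter_le _ _)
        omega
      rw [hzero, ← monomialSpan_empty, ← meetSet_eq_empty (B := fun _ : Fin 1 => B i)
        (d := fun _ => d i) (i := 0) hi]
      exact isMatchingMatroidalOfVeroneseType_monomialSpan_meetSet (fun _ => hne i)
        fun i j hij => absurd (Subsingleton.elim i j) hij

end MonomialSpan

/-! ### Symbolic powers of intersections of monomial primes -/

section SymbolicPower

variable {K : Type*} [Field K] {n : ℕ}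

/-- The substitution `x_i ↦ t x_i` for `i ∈ F`, `x_i ↦ x_i` otherwise. -/
def gradingHom (K : Type*) [Field K] (F : Finset (Fin n)) :
    MvPolynomial (Fin n) K →ₐ[K] Polynomial (MvPolynomial (Fin n) K) :=
  aeval fun i => (if i ∈ F then Polynomial.X else 1) * Polynomial.C (X i)

theorem gradingHom_monomial (F : Finset (Fin n)) (a : Fin n →₀ ℕ) (c : K) :
    gradingHom K F (monomial a c) =
      Polynomial.X ^ (∑ p ∈ F, a p) * Polynomial.C (monomial a c) := by
  rw [gradingHom, aeval_monomial, monomial_eq, Finsupp.prod_fintype _ _ (by simp),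
    Finsupp.prod_fintype _ _ (by simp)]
  simp only [mul_pow, Finset.prod_mul_distrib, ite_pow, one_pow, Finset.prod_ite_mem,
    Finset.univ_inter, Finset.prod_pow_eq_pow_sum, map_mul, map_prod, map_pow]
  rw [IsScalarTower.algebraMap_apply K (MvPolynomial (Fin n) K), Polynomial.algebraMap_eq,
    MvPolynomial.algebraMap_eq]
  ring

theorem coeff_coeff_gradingHom (F : Finset (Fin n)) (f : MvPolynomial (Fin n) K) (j : ℕ)
    (a : Fin n →₀ ℕ) :
    coeff a ((gradingHom K F f).coeff j) = if ∑ p ∈ F, a p = j then coeff a f else 0 := by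
  classical
  induction f using MvPolynomial.induction_on' with
  | monomial b c =>
    rw [gradingHom_monomial, Polynomial.coeff_X_pow_mul', Polynomial.coeff_C, coeff_monomial]
    by_cases hab : b = a
    · subst hab
      by_cases h : ∑ p ∈ F, b p = j
      · simp [h]
      · by_cases h' : ∑ p ∈ F, b p ≤ j
        · have : j - ∑ p ∈ F, b p ≠ 0 := by omega
          simp [h, h', this]
        · simp [h, h']
    · split_ifs <;> simp [coeff_monomial, hab]
  | add p q hp hq =>
    rw [map_add, Polynomial.coeff_add, coeff_add, hp, hq, coeff_add]
    split_ifs <;> simp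

/-- The order of `f` along `P_F` becomes a `t`-adic order; since `t` is prime, primality of `P_F`
and primariness of its powers become statements about divisibility by `t`. -/
theorem X_pow_dvd_gradingHom_iff (F : Finset (Fin n)) (f : MvPolynomial (Fin n) K) (k : ℕ) :
    Polynomial.X ^ k ∣ gradingHom K F f ↔ ∀ a ∈ f.support, k ≤ ∑ p ∈ F, a p := by
  rw [Polynomial.X_pow_dvd_iff]
  constructor
  · intro h a ha
    by_contra! hlt
    have := coeff_coeff_gradingHom F f (∑ p ∈ F, a p) a
    rw [h _ hlt, if_pos rfl, coeff_zero] at this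
    exact (mem_support_iff.1 ha) this.symm
  · intro h j hj
    ext a
    rw [coeff_coeff_gradingHom, coeff_zero]
    split_ifs with hs
    · by_contra hne
      have := h a (mem_support_iff.2 hne)
      omega
    · rfl

theorem mem_monomialPrime_iff {F : Finset (Fin n)} {f : MvPolynomial (Fin n) K} :
    f ∈ monomialPrime K F ↔ ∀ a ∈ f.support, ∃ p ∈ F, a p ≠ 0 :=
  mem_ideal_span_X_image

theorem mem_monomialPrime_iff_X_dvd {F : Finset (Fin n)} {f : MvPolynomial (Fin n) K} :
    f ∈ monomialPrime K F ↔ Polynomial.X ∣ gradingHom K F f := by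
  rw [← pow_one Polynomial.X, X_pow_dvd_gradingHom_iff, mem_monomialPrime_iff]
  refine forall₂_congr fun a _ => ?_
  rw [Nat.one_le_iff_ne_zero, ne_eq, Finset.sum_eq_zero_iff]
  push Not
  rfl

instance isPrime_monomialPrime (F : Finset (Fin n)) : (monomialPrime K F).IsPrime := by
  have : monomialPrime K F = Ideal.comap (gradingHom K F) (Ideal.span {Polynomial.X}) := by
    ext f
    rw [Ideal.mem_comap, Ideal.mem_span_singleton, mem_monomialPrime_iff_X_dvd]
  rw [this]
  have : (Ideal.span {(Polynomial.X : Polynomial (MvPolynomial (Fin n) K))}).IsPrime :=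
    (Ideal.span_singleton_prime Polynomial.X_ne_zero).2 Polynomial.prime_X
  exact Ideal.comap_isPrime _ _

theorem monomial_mem_monomialPrime_pow {F : Finset (Fin n)} {a : Fin n →₀ ℕ} {k : ℕ}
    (h : k ≤ ∑ p ∈ F, a p) : monomial a (1 : K) ∈ monomialPrime K F ^ k := by
  refine Ideal.pow_le_pow_right h ?_
  rw [monomial_eq, C_1, one_mul, Finsupp.prod_fintype _ _ (by simp),
    ← Finset.prod_mul_prod_compl F]
  refine Ideal.mul_mem_right _ _ ?_
  rw [← Finset.prod_pow_eq_pow_sum]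
  refine Ideal.prod_mem_prod fun p hp => Ideal.pow_mem_pow ?_ _
  exact Ideal.subset_span ⟨p, hp, rfl⟩

theorem mem_monomialPrime_pow_iff {F : Finset (Fin n)} {f : MvPolynomial (Fin n) K} {k : ℕ} :
    f ∈ monomialPrime K F ^ k ↔ ∀ a ∈ f.support, k ≤ ∑ p ∈ F, a p := by
  constructor
  · intro hf
    rw [← X_pow_dvd_gradingHom_iff]
    have hle : (monomialPrime K F).map (gradingHom K F) ≤ Ideal.span {Polynomial.X} := by
      rw [Ideal.map_le_iff_le_comap]
      intro g hg
      rw [Ideal.mem_comap, Ideal.mem_span_singleton]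
      exact mem_monomialPrime_iff_X_dvd.1 hg
    rw [← Ideal.mem_span_singleton, ← Ideal.span_singleton_pow]
    refine Ideal.pow_right_mono hle k ?_
    rw [← Ideal.map_pow]
    exact Ideal.mem_map_of_mem _ hf
  · intro h
    rw [f.as_sum]
    refine Ideal.sum_mem _ fun a ha => ?_
    rw [← mul_one (coeff a f), ← C_mul_monomial]
    exact Ideal.mul_mem_left _ _ (monomial_mem_monomialPrime_pow (h a ha))

theorem mem_monomialPrime_pow_of_mul_mem {F : Finset (Fin n)} {s f : MvPolynomial (Fin n) K}
    {k : ℕ} (hs : s ∉ monomialPrime K F) (h : s * f ∈ monomialPrime K F ^ k) :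
    f ∈ monomialPrime K F ^ k := by
  rw [mem_monomialPrime_pow_iff, ← X_pow_dvd_gradingHom_iff] at h ⊢
  rw [map_mul] at h
  rw [mem_monomialPrime_iff_X_dvd] at hs
  exact Polynomial.prime_X.pow_dvd_of_dvd_mul_left k hs h

theorem prod_X_compl_notMem (F : Finset (Fin n)) :
    ∏ q ∈ Fᶜ, (X q : MvPolynomial (Fin n) K) ∉ monomialPrime K F := by
  rw [(isPrime_monomialPrime F).prod_mem_iff]
  rintro ⟨q, hq, hX⟩
  rw [mem_monomialPrime_iff, support_X] at hX
  obtain ⟨p, hp, h⟩ := hX _ (Finset.mem_singleton_self _)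
  rw [Finset.mem_compl] at hq
  rw [Finsupp.single_apply] at h
  split_ifs at h with h'
  exacts [hq (h' ▸ hp), h rfl]

theorem prod_X_compl_mem {F G : Finset (Fin n)} (h : ¬ G ⊆ F) :
    ∏ q ∈ Fᶜ, (X q : MvPolynomial (Fin n) K) ∈ monomialPrime K G := by
  obtain ⟨q, hqG, hqF⟩ := Finset.not_subset.1 h
  rw [(isPrime_monomialPrime G).prod_mem_iff]
  exact ⟨q, Finset.mem_compl.2 hqF, Ideal.subset_span ⟨q, hqG, rfl⟩⟩

variable {𝓕 : Finset (Finset (Fin n))}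

/-- Every other member of the antichain contains a variable outside `F`. The product of those
variables avoids `P_F`, so it witnesses that `P_F` is associated and serves as denominator when
localizing at `P_F`. -/
theorem monomialPrime_mul_le_inf (h𝓕 : IsAntichain (· ⊆ ·) (𝓕 : Set (Finset (Fin n))))
    {F : Finset (Fin n)} (hF : F ∈ 𝓕) :
    monomialPrime K F * Ideal.span {∏ q ∈ Fᶜ, (X q : MvPolynomial (Fin n) K)} ≤
      𝓕.inf (monomialPrime K) := by
  refine Finset.le_inf fun G hG => ?_
  by_cases h : G = F
  · exact h ▸ Ideal.mul_le_left
  · refine Ideal.mul_le_right.trans ?_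
    rw [Ideal.span_singleton_le_iff_mem]
    exact prod_X_compl_mem (h𝓕 hG hF h)

theorem mem_inf_monomialPrime {f : MvPolynomial (Fin n) K} :
    f ∈ 𝓕.inf (monomialPrime K) ↔ ∀ F ∈ 𝓕, f ∈ monomialPrime K F := by
  rw [Submodule.mem_finsetInf]

theorem monomialPrime_mem_associatedPrimes
    (h𝓕 : IsAntichain (· ⊆ ·) (𝓕 : Set (Finset (Fin n)))) {F : Finset (Fin n)} (hF : F ∈ 𝓕) :
    monomialPrime K F ∈ associatedPrimes (MvPolynomial (Fin n) K)
      (MvPolynomial (Fin n) K ⧸ 𝓕.inf (monomialPrime K)) := by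
  rw [AssociatedPrimes.mem_iff, isAssociatedPrime_iff]
  refine ⟨inferInstance, Ideal.Quotient.mk _ (∏ q ∈ Fᶜ, X q), ?_⟩
  ext f
  rw [Submodule.mem_colon_singleton, Submodule.mem_bot, ← Ideal.Quotient.mk_eq_mk,
    ← Submodule.Quotient.mk_smul, Submodule.Quotient.mk_eq_zero, smul_eq_mul]
  constructor
  · intro hf
    exact monomialPrime_mul_le_inf h𝓕 hF
      (Ideal.mul_mem_mul hf (Ideal.mem_span_singleton_self _))
  · intro hf
    exact ((isPrime_monomialPrime F).mem_or_mem (mem_inf_monomialPrime.1 hf F hF)).resolve_right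
      (prod_X_compl_notMem F)

/-- The annihilator of the class of `g` is the intersection of those `P_F` that do not contain `g`.
If it is prime, it contains one of these finitely many primes, hence equals it. -/
theorem exists_eq_monomialPrime_of_mem_associatedPrimes {P : Ideal (MvPolynomial (Fin n) K)}
    (hP : P ∈ associatedPrimes (MvPolynomial (Fin n) K)
      (MvPolynomial (Fin n) K ⧸ 𝓕.inf (monomialPrime K))) :
    ∃ F ∈ 𝓕, P = monomialPrime K F := by
  classical
  rw [AssociatedPrimes.mem_iff, isAssociatedPrime_iff] at hP
  obtain ⟨hprime, x, hx⟩ := hP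
  obtain ⟨g, rfl⟩ := Ideal.Quotient.mk_surjective x
  have hmem : ∀ f, f ∈ P ↔ ∀ F ∈ 𝓕.filter (g ∉ monomialPrime K ·), f ∈ monomialPrime K F := by
    intro f
    rw [hx, Submodule.mem_colon_singleton, Submodule.mem_bot, ← Ideal.Quotient.mk_eq_mk,
      ← Submodule.Quotient.mk_smul, Submodule.Quotient.mk_eq_zero, smul_eq_mul,
      mem_inf_monomialPrime]
    constructor
    · intro h F hF
      rw [Finset.mem_filter] at hF
      exact ((isPrime_monomialPrime F).mem_or_mem (h F hF.1)).resolve_right hF.2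
    · intro h F hF
      by_cases hg : g ∈ monomialPrime K F
      · exact Ideal.mul_mem_left _ _ hg
      · exact Ideal.mul_mem_right _ _ (h F (Finset.mem_filter.2 ⟨hF, hg⟩))
  have hle : (𝓕.filter (g ∉ monomialPrime K ·)).inf (monomialPrime K) ≤ P := fun f hf =>
    (hmem f).2 (mem_inf_monomialPrime.1 hf)
  obtain ⟨F, hF, hFP⟩ := hprime.inf_le'.1 hle
  exact ⟨F, (Finset.mem_filter.1 hF).1, le_antisymm (fun f hf => (hmem f).1 hf F hF) hFP⟩

theorem isUpperSet_sum_le (𝓕 : Finset (Finset (Fin n))) (k : ℕ) :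
    IsUpperSet {a : Fin n →₀ ℕ | ∀ F ∈ 𝓕, k ≤ ∑ p ∈ F, a p} := fun _ _ hab ha F hF =>
  (ha F hF).trans (Finset.sum_le_sum fun p _ => hab p)

/-- The symbolic powers of an irredundant intersection of monomial primes. -/
theorem symbolicPower_inf_monomialPrime
    (h𝓕 : IsAntichain (· ⊆ ·) (𝓕 : Set (Finset (Fin n)))) (k : ℕ) :
    symbolicPower (𝓕.inf (monomialPrime K)) k =
      monomialSpan {a | ∀ F ∈ 𝓕, k ≤ ∑ p ∈ F, a p} := by
  apply le_antisymm
  · intro f hf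
    rw [mem_monomialSpan_of_isUpperSet (isUpperSet_sum_le 𝓕 k)]
    intro a ha F hF
    rw [symbolicPower, Submodule.mem_iInf] at hf
    have hf' := hf ⟨_, monomialPrime_mem_associatedPrimes h𝓕 hF⟩
    rw [Ideal.mem_comap,
      IsLocalization.algebraMap_mem_map_algebraMap_iff (monomialPrime K F).primeCompl] at hf'
    obtain ⟨s, hs, hsf⟩ := hf'
    have hle : 𝓕.inf (monomialPrime K) ≤ monomialPrime K F := Finset.inf_le hF
    exact mem_monomialPrime_pow_iff.1
      (mem_monomialPrime_pow_of_mul_mem hs (Ideal.pow_right_mono hle k hsf)) a ha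
  · rw [monomialSpan_le_iff]
    intro a ha
    rw [symbolicPower, Submodule.mem_iInf]
    rintro ⟨P, hP⟩
    obtain ⟨F, hF, rfl⟩ := exists_eq_monomialPrime_of_mem_associatedPrimes hP
    rw [Ideal.mem_comap,
      IsLocalization.algebraMap_mem_map_algebraMap_iff (monomialPrime K F).primeCompl]
    refine ⟨(∏ q ∈ Fᶜ, X q) ^ k, fun h => prod_X_compl_notMem F
      ((isPrime_monomialPrime F).mem_of_pow_mem _ h), ?_⟩
    have hmem := Ideal.mul_mem_mul (monomial_mem_monomialPrime_pow (K := K) (ha F hF))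
      (Ideal.pow_mem_pow (Ideal.mem_span_singleton_self (∏ q ∈ Fᶜ, X q)) k)
    rw [← mul_pow] at hmem
    rw [mul_comm]
    exact Ideal.pow_right_mono (monomialPrime_mul_le_inf h𝓕 hF) k hmem

theorem inf_monomialPrime_eq : 𝓕.inf (monomialPrime K) =
    monomialSpan {a | ∀ F ∈ 𝓕, ∃ p ∈ F, a p ≠ 0} := by
  ext f
  rw [mem_monomialSpan_of_isUpperSet, mem_inf_monomialPrime]
  · simp only [mem_monomialPrime_iff]
    exact ⟨fun h a ha F hF => h F hF a ha, fun h F hF a ha => h a ha F hF⟩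
  · intro a b hab ha F hF
    obtain ⟨p, hp, h⟩ := ha F hF
    have := hab p
    exact ⟨p, hp, by omega⟩

end SymbolicPower

/-! ### Koszul homology, linear quotients and regularity -/

section Koszul

variable {K : Type*} [Field K] {n : ℕ}

theorem koszulDifferential_apply (c : Finset (Fin n) → MvPolynomial (Fin n) K)
    (G : Finset (Fin n)) :
    koszulDifferential K n c G =
      ∑ p ∈ Gᶜ, (-1) ^ (G.filter (· < p)).card * (X p * c (insert p G)) :=
  rfl

theorem koszulDifferential_mem {J : Ideal (MvPolynomial (Fin n) K)}
    {c : Finset (Fin n) → MvPolynomial (Fin n) K} (hc : ∀ G, c G ∈ J) (G : Finset (Fin n)) :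
    koszulDifferential K n c G ∈ J := by
  rw [koszulDifferential_apply]
  exact Ideal.sum_mem _ fun p _ => Ideal.mul_mem_left _ _ (Ideal.mul_mem_left _ _ (hc _))

theorem koszulDifferential_mul (f : MvPolynomial (Fin n) K)
    (c : Finset (Fin n) → MvPolynomial (Fin n) K) :
    koszulDifferential K n (fun G => f * c G) = fun G => f * koszulDifferential K n c G := by
  funext G
  rw [koszulDifferential_apply, koszulDifferential_apply, Finset.mul_sum]
  exact Finset.sum_congr rfl fun p _ => by ring

theorem neg_one_pow_card_filter_insert {G : Finset (Fin n)} {r : Fin n} (hr : r ∉ G) (p : Fin n) :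
    (-1 : MvPolynomial (Fin n) K) ^ ((insert r G).filter (· < p)).card =
      (if r < p then -1 else 1) * (-1) ^ (G.filter (· < p)).card := by
  rw [Finset.filter_insert]
  split_ifs
  · rw [Finset.card_insert_of_notMem fun h => hr (Finset.mem_filter.1 h).1, pow_succ']
  · rw [one_mul]

theorem koszulDifferential_koszulDifferential (c : Finset (Fin n) → MvPolynomial (Fin n) K) :
    koszulDifferential K n (koszulDifferential K n c) = 0 := by
  funext G
  simp only [koszulDifferential_apply, Finset.mul_sum, Pi.zero_apply]
  rw [Finset.sum_sigma']
  refine Finset.sum_involution (fun x _ => ⟨x.2, x.1⟩) ?_ ?_ ?_ ?_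
  · rintro ⟨p, q⟩ h
    simp only [Finset.mem_sigma, Finset.mem_compl, Finset.mem_insert, not_or] at h
    obtain ⟨hp, hqp, hq⟩ := h
    simp only
    rw [neg_one_pow_card_filter_insert hp, neg_one_pow_card_filter_insert hq,
      Finset.insert_comm q p]
    rcases lt_or_gt_of_ne hqp with h | h
    · rw [if_neg h.not_gt, if_pos h]
      ring
    · rw [if_pos h, if_neg h.not_gt]
      ring
  · rintro ⟨p, q⟩ h _ heq
    simp only [Finset.mem_sigma, Finset.mem_compl, Finset.mem_insert, not_or] at h
    exact h.2.1 (congrArg Sigma.fst heq)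
  · rintro ⟨p, q⟩ h
    simp only [Finset.mem_sigma, Finset.mem_compl, Finset.mem_insert, not_or] at h ⊢
    exact ⟨h.2.2, fun h' => h.2.1 h'.symm, h.1⟩
  · rintro ⟨p, q⟩ _
    rfl

/-- Exterior multiplication by `e_r`. -/
def koszulWedge (r : Fin n) (c : Finset (Fin n) → MvPolynomial (Fin n) K) :
    Finset (Fin n) → MvPolynomial (Fin n) K := fun G =>
  if r ∈ G then (-1) ^ ((G.erase r).filter (· < r)).card * c (G.erase r) else 0

theorem neg_one_pow_mul_self_mul (k : ℕ) (f : MvPolynomial (Fin n) K) :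
    (-1) ^ k * ((-1) ^ k * f) = f := by
  rw [← mul_assoc, ← mul_pow, neg_one_mul, neg_neg, one_pow, one_mul]

/-- Wedging with `e_r` is a contracting homotopy for multiplication by `x_r`; the signs cancel
because `r` and `p` are inserted in opposite orders. -/
theorem koszulDifferential_koszulWedge (r : Fin n)
    (c : Finset (Fin n) → MvPolynomial (Fin n) K) (G : Finset (Fin n)) :
    koszulDifferential K n (koszulWedge r c) G + koszulWedge r (koszulDifferential K n c) G =
      X r * c G := by
  by_cases hr : r ∈ G
  · obtain ⟨H, hH, rfl⟩ : ∃ H, r ∉ H ∧ G = insert r H :=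
      ⟨G.erase r, Finset.notMem_erase r G, (Finset.insert_erase hr).symm⟩
    have hcompl : Hᶜ = insert r (insert r H)ᶜ := by
      ext x
      simp only [Finset.mem_compl, Finset.mem_insert]
      by_cases h : x = r
      · simp [h, hH]
      · simp [h]
    rw [koszulWedge, if_pos hr, Finset.erase_insert hH, koszulDifferential_apply,
      koszulDifferential_apply, hcompl,
      Finset.sum_insert fun h => Finset.mem_compl.1 h (Finset.mem_insert_self r H), mul_add,
      neg_one_pow_mul_self_mul, Finset.mul_sum, add_left_comm, ← Finset.sum_add_distrib,
      Finset.sum_eq_zero, add_zero]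
    intro p hp
    simp only [Finset.mem_compl, Finset.mem_insert, not_or] at hp
    obtain ⟨hpr, hpH⟩ := hp
    have herase : (insert p (insert r H)).erase r = insert p H := by
      rw [Finset.insert_comm, Finset.erase_insert]
      simp [hH, Ne.symm hpr]
    rw [koszulWedge, if_pos (Finset.mem_insert_of_mem hr), herase,
      neg_one_pow_card_filter_insert hH, neg_one_pow_card_filter_insert hpH]
    rcases lt_or_gt_of_ne hpr with h | h
    · rw [if_neg h.not_gt, if_pos h]
      ring
    · rw [if_pos h, if_neg h.not_gt]
      ring
  · rw [koszulWedge, if_neg hr, add_zero, koszulDifferential_apply,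
      Finset.sum_eq_single_of_mem r (Finset.mem_compl.2 hr)]
    · rw [koszulWedge, if_pos (Finset.mem_insert_self r G), Finset.erase_insert hr,
        mul_left_comm, neg_one_pow_mul_self_mul]
    · intro p _ hpr
      rw [koszulWedge, if_neg (by simp [hr, Ne.symm hpr]), mul_zero, mul_zero]

theorem koszulWedge_mem {J : Ideal (MvPolynomial (Fin n) K)} (r : Fin n)
    {c : Finset (Fin n) → MvPolynomial (Fin n) K} (hc : ∀ G, c G ∈ J) (G : Finset (Fin n)) :
    koszulWedge r c G ∈ J := by
  unfold koszulWedge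
  split_ifs
  exacts [Ideal.mul_mem_left _ _ (hc _), J.zero_mem]

theorem X_notMem_monomialPrime {T : Finset (Fin n)} {p : Fin n} (hp : p ∉ T) :
    (X p : MvPolynomial (Fin n) K) ∉ monomialPrime K T := by
  rw [mem_monomialPrime_iff, support_X]
  intro h
  obtain ⟨q, hq, h⟩ := h _ (Finset.mem_singleton_self _)
  rw [Finsupp.single_apply] at h
  split_ifs at h with h'
  exacts [hp (h' ▸ hq), h rfl]

theorem monomialPrime_insert (T : Finset (Fin n)) (p : Fin n) :
    monomialPrime K (insert p T) = monomialPrime K T ⊔ Ideal.span {X p} := by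
  rw [monomialPrime, monomialPrime, Finset.coe_insert, Set.image_insert_eq, Ideal.span_insert,
    sup_comm]

/-- The Koszul homology of `K[x_1, …, x_n] / (x_i : i ∈ T)` is concentrated in coefficient
degree `0`. -/
theorem exists_sub_koszulDifferential_mem_monomialPrime (T : Finset (Fin n))
    {g : Finset (Fin n) → MvPolynomial (Fin n) K} (hg : ∀ G, g G ∈ monomialPrime K Finset.univ)
    (hdg : ∀ G, koszulDifferential K n g G ∈ monomialPrime K T) :
    ∃ h, ∀ G, g G - koszulDifferential K n h G ∈ monomialPrime K T := by
  -- The induction is on the set of variables outside `T`. When `T` contains all variables, the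
  -- hypothesis `hg` already says that `g` vanishes in the quotient.
  suffices H : ∀ U T : Finset (Fin n), Tᶜ = U →
      (∀ G, koszulDifferential K n g G ∈ monomialPrime K T) →
      ∃ h, ∀ G, g G - koszulDifferential K n h G ∈ monomialPrime K T from H _ T rfl hdg
  intro U
  induction U using Finset.induction_on with
  | empty =>
    intro T hT _
    rw [Finset.compl_eq_empty_iff] at hT
    subst hT
    exact ⟨0, fun G => by simpa using hg G⟩
  | insert p U hpU ih =>
    intro T hT hdT
    have hpT : p ∉ T := Finset.mem_compl.1 (hT ▸ Finset.mem_insert_self p U)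
    have hTU : (insert p T)ᶜ = U := by
      rw [Finset.compl_insert, hT, Finset.erase_insert hpU]
    have hle : monomialPrime K T ≤ monomialPrime K (insert p T) := by
      rw [monomialPrime_insert]
      exact le_sup_left
    obtain ⟨h₁, hh₁⟩ := ih (insert p T) hTU fun G => hle (hdT G)
    have hsplit : ∀ G, ∃ y, g G - koszulDifferential K n h₁ G - X p * y ∈ monomialPrime K T := by
      intro G
      have := hh₁ G
      rw [monomialPrime_insert, Submodule.mem_sup] at this
      obtain ⟨a, ha, b, hb, hab⟩ := this
      obtain ⟨y, rfl⟩ := Ideal.mem_span_singleton'.1 hb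
      refine ⟨y, ?_⟩
      rw [← hab]
      convert ha using 1
      ring
    choose y hy using hsplit
    -- Since `x_p` is a nonzerodivisor modulo `P_T`, `y` is a cycle there, and the homotopy then
    -- makes `x_p y` the boundary of `e_p ∧ y`.
    have hdy : ∀ G, koszulDifferential K n y G ∈ monomialPrime K T := by
      intro G
      have h1 := koszulDifferential_mem hy G
      have h2 : koszulDifferential K n (fun G => g G - koszulDifferential K n h₁ G - X p * y G) G =
          koszulDifferential K n g G - X p * koszulDifferential K n y G := by
        have : (fun G => g G - koszulDifferential K n h₁ G - X p * y G) =
            g - koszulDifferential K n h₁ - fun G => X p * y G := rfl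
        rw [this, map_sub, map_sub, koszulDifferential_koszulDifferential, koszulDifferential_mul]
        simp
      rw [h2] at h1
      have h3 := (Submodule.sub_mem_iff_right _ (hdT G)).1 h1
      exact ((isPrime_monomialPrime T).mem_or_mem h3).resolve_left (X_notMem_monomialPrime hpT)
    refine ⟨h₁ + koszulWedge p y, fun G => ?_⟩
    have h4 := Ideal.add_mem _ (hy G) (koszulWedge_mem p hdy G)
    convert h4 using 1
    rw [← koszulDifferential_koszulWedge p y G, map_add, Pi.add_apply]
    ring

theorem homogeneousComponent_monomial_mul (u : Fin n →₀ ℕ) (e : ℕ)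
    (f : MvPolynomial (Fin n) K) :
    homogeneousComponent (u.degree + e) (monomial u 1 * f) =
      monomial u 1 * homogeneousComponent e f := by
  ext m
  rw [coeff_homogeneousComponent, coeff_monomial_mul', coeff_monomial_mul',
    coeff_homogeneousComponent]
  by_cases h : u ≤ m
  · obtain ⟨v, rfl⟩ := exists_add_of_le h
    rw [map_add]
    simp
  · simp [h]

theorem homogeneousComponent_koszulDifferential (e : ℕ)
    (h : Finset (Fin n) → MvPolynomial (Fin n) K) (G : Finset (Fin n)) :
    homogeneousComponent (e + 1) (koszulDifferential K n h G) =
      koszulDifferential K n (fun G => homogeneousComponent e (h G)) G := by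
  rw [koszulDifferential_apply, koszulDifferential_apply, map_sum]
  refine Finset.sum_congr rfl fun p _ => ?_
  have hX : homogeneousComponent (e + 1) (X p * h (insert p G)) =
      X p * homogeneousComponent e (h (insert p G)) := by
    have := homogeneousComponent_monomial_mul (Finsupp.single p 1) e (h (insert p G))
    rwa [Finsupp.degree_single, add_comm] at this
  rw [← hX]
  rcases neg_one_pow_eq_or (MvPolynomial (Fin n) K) (G.filter (· < p)).card with h | h <;>
    simp [h]

theorem homogeneousComponent_mem_monomialSpan {A : Set (Fin n →₀ ℕ)}
    {f : MvPolynomial (Fin n) K} (hf : f ∈ monomialSpan A) (d : ℕ) :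
    homogeneousComponent d f ∈ monomialSpan A := by
  rw [mem_monomialSpan] at hf ⊢
  intro m hm
  rw [mem_support_iff, coeff_homogeneousComponent] at hm
  split_ifs at hm
  · exact hf m (mem_support_iff.2 hm)
  · exact absurd rfl hm

theorem homogeneousComponent_mem_monomialPrime {T : Finset (Fin n)}
    {f : MvPolynomial (Fin n) K} (hf : f ∈ monomialPrime K T) (d : ℕ) :
    homogeneousComponent d f ∈ monomialPrime K T := by
  rw [mem_monomialPrime_iff] at hf ⊢
  intro m hm
  rw [mem_support_iff, coeff_homogeneousComponent] at hm
  split_ifs at hm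
  · exact hf m (mem_support_iff.2 hm)
  · exact absurd rfl hm

/-- A sequence of exponents in which every earlier member can be replaced by a member whose colon
with the current one is a variable. -/
def HasExchange {m : ℕ} (u : Fin m → (Fin n →₀ ℕ)) : Prop :=
  ∀ i j, j < i → ∃ p, u i p < u j p ∧ ∃ l < i, u l ≤ u i + Finsupp.single p 1

/-- The variables in the colon ideal of the predecessors of `u i` by `u i`. -/
def colonVariables {m : ℕ} (u : Fin m → (Fin n →₀ ℕ)) (i : Fin m) : Finset (Fin n) :=
  open Classical in Finset.univ.filter fun p => ∃ l < i, u l ≤ u i + Finsupp.single p 1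

/-- If an earlier `u j` divides `x^(u i + a)`, then `a` is positive wherever `u j` exceeds `u i`;
exchange picks such a place where the variable alone lies in the colon ideal. -/
theorem monomial_mul_mem_iff {m : ℕ} {u : Fin m → (Fin n →₀ ℕ)} (hu : HasExchange u) (i : Fin m)
    (f : MvPolynomial (Fin n) K) :
    monomial (u i) 1 * f ∈ (monomialSpan (u '' {j | j < i}) : Ideal (MvPolynomial (Fin n) K)) ↔
      f ∈ monomialPrime K (colonVariables u i) := by
  rw [mem_monomialSpan, mem_monomialPrime_iff]
  have hsupp : ∀ b, b ∈ (monomial (u i) 1 * f).support ↔ ∃ a ∈ f.support, b = u i + a := by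
    intro b
    rw [mem_support_iff, coeff_monomial_mul']
    constructor
    · intro h
      split_ifs at h with hle
      · exact ⟨b - u i, by simpa using h, (add_tsub_cancel_of_le hle).symm⟩
      · exact absurd rfl h
    · rintro ⟨a, ha, rfl⟩
      simpa using ha
  constructor
  · intro h a ha
    obtain ⟨_, ⟨j, hj, rfl⟩, hle⟩ := h _ ((hsupp _).2 ⟨a, ha, rfl⟩)
    obtain ⟨p, hp, l, hl, hlp⟩ := hu i j hj
    refine ⟨p, by simpa [colonVariables] using ⟨l, hl, hlp⟩, ?_⟩
    have := hle p
    rw [Finsupp.add_apply] at this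
    omega
  · intro h b hb
    obtain ⟨a, ha, rfl⟩ := (hsupp b).1 hb
    obtain ⟨p, hp, hap⟩ := h a ha
    obtain ⟨l, hl, hlp⟩ : ∃ l < i, u l ≤ u i + Finsupp.single p 1 := by
      simpa [colonVariables] using hp
    refine ⟨u l, ⟨l, hl, rfl⟩, hlp.trans (add_le_add_right ?_ _)⟩
    rw [Finsupp.single_le_iff]
    omega

theorem hasLinearQuotients_of_hasExchange {m : ℕ} {u : Fin m → (Fin n →₀ ℕ)} (hu : HasExchange u)
    (hanti : ∀ i j, u i ≤ u j → i = j) :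
    HasLinearQuotients (monomialSpan (Set.range u) : Ideal (MvPolynomial (Fin n) K)) := by
  refine ⟨⟨_, rfl⟩, m, u, fun i j h => hanti i j h.le, ?_, fun i => ⟨colonVariables u i, ?_⟩⟩
  · ext a
    simp only [minGens, monomial_mem_monomialSpan one_ne_zero, Set.mem_ofPred_eq]
    constructor
    · rintro ⟨i, rfl⟩
      refine ⟨⟨_, ⟨i, rfl⟩, le_rfl⟩, ?_⟩
      rintro b ⟨_, ⟨j, rfl⟩, hjb⟩ hb
      rwa [← hanti j i (hjb.trans hb)]
    · rintro ⟨⟨b, hb, hba⟩, hmin⟩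
      rwa [le_antisymm (hmin ⟨b, hb, le_rfl⟩ hba) hba]
  · ext f
    rw [Submodule.mem_colon_singleton, smul_eq_mul, mul_comm, monomial_mul_mem_iff hu]
    rfl

theorem monomialSpan_insert (a : Fin n →₀ ℕ) (A : Set (Fin n →₀ ℕ)) :
    (monomialSpan (insert a A) : Ideal (MvPolynomial (Fin n) K)) =
      Ideal.span {monomial a 1} ⊔ monomialSpan A := by
  rw [monomialSpan, Set.image_insert_eq, Ideal.span_insert]
  rfl

/-- Koszul homology of an ideal with linear quotients vanishes above the degrees of the
generators. -/
theorem exists_koszulDifferential_eq {m : ℕ} {u : Fin m → (Fin n →₀ ℕ)} (hu : HasExchange u)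
    {d : ℕ} (hd : ∀ i, (u i).degree < d) {c : Finset (Fin n) → MvPolynomial (Fin n) K}
    (hc : ∀ G, c G ∈ monomialSpan (Set.range u)) (hcd : ∀ G, (c G).IsHomogeneous d)
    (hdc : koszulDifferential K n c = 0) :
    ∃ h, (∀ G, h G ∈ monomialSpan (Set.range u)) ∧ koszulDifferential K n h = c := by
  -- Generators are added one at a time: the quotient of consecutive ideals is `S / P_T` shifted by
  -- the degree of the new generator, with `T` its colon variables.
  suffices H : ∀ k ≤ m, ∀ c : Finset (Fin n) → MvPolynomial (Fin n) K,
      (∀ G, c G ∈ monomialSpan (u '' {l | l.val < k})) → (∀ G, (c G).IsHomogeneous d) →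
      koszulDifferential K n c = 0 →
      ∃ h, (∀ G, h G ∈ monomialSpan (u '' {l | l.val < k})) ∧ koszulDifferential K n h = c by
    have huniv : u '' {l | l.val < m} = Set.range u := by
      rw [← Set.image_univ]
      congr 1
      ext l
      simp
    have := H m le_rfl c
    rw [huniv] at this
    exact this hc hcd hdc
  intro k
  induction k with
  | zero =>
    intro _ c hc _ _
    refine ⟨0, fun G => Ideal.zero_mem _, ?_⟩
    funext G
    have := hc G
    simp only [Nat.not_lt_zero, Set.ofPred_false, Set.image_empty, monomialSpan_empty] at this
    rw [map_zero]
    exact this.symm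
  | succ k ih =>
    intro hk c hc hcd hdc
    let i : Fin m := ⟨k, hk⟩
    have hset : u '' {l | l.val < k + 1} = insert (u i) (u '' {l | l.val < k}) := by
      rw [← Set.image_insert_eq]
      congr 1
      ext l
      simp only [i, Set.mem_ofPred_eq, Set.mem_insert_iff, Fin.ext_iff]
      omega
    have hprev : {l : Fin m | l.val < k} = {l | l < i} := rfl
    -- Strictness in `hd` gives the `+ 1`: the coefficients of the new generator have positive
    -- degree, where `S / P_T` has no Koszul homology.
    obtain ⟨e, he⟩ : ∃ e, d = (u i).degree + (e + 1) :=
      ⟨d - (u i).degree - 1, by have := hd i; omega⟩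
    have hsplit : ∀ G, ∃ g, homogeneousComponent (e + 1) g = g ∧
        c G - monomial (u i) 1 * g ∈ monomialSpan (u '' {l | l.val < k}) := by
      intro G
      have := hc G
      rw [hset, monomialSpan_insert, Submodule.mem_sup] at this
      obtain ⟨a, ha, b, hb, hab⟩ := this
      obtain ⟨y, rfl⟩ := Ideal.mem_span_singleton'.1 ha
      refine ⟨homogeneousComponent (e + 1) y,
        by rw [homogeneousComponent_of_mem (homogeneousComponent_mem _ _), if_pos rfl], ?_⟩
      rw [← homogeneousComponent_monomial_mul, ← he]
      have h1 := homogeneousComponent_mem_monomialSpan hb d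
      have h2 : homogeneousComponent d (c G) = c G := by
        rw [homogeneousComponent_of_mem (hcd G), if_pos rfl]
      rw [← h2, ← hab, map_add, mul_comm y]
      simpa using h1
    choose g hgd hg using hsplit
    have hgm : ∀ G, g G ∈ monomialPrime K Finset.univ := by
      intro G
      rw [mem_monomialPrime_iff]
      intro a ha
      by_contra! h
      have ha0 : a = 0 := Finsupp.ext fun p => h p (Finset.mem_univ p)
      rw [← hgd G, ha0, mem_support_iff, coeff_homogeneousComponent, if_neg (by simp)] at ha
      exact ha rfl
    have hdg : ∀ G, koszulDifferential K n g G ∈ monomialPrime K (colonVariables u i) := by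
      intro G
      rw [← monomial_mul_mem_iff hu, ← hprev]
      have h1 := koszulDifferential_mem hg G
      have h2 : (fun G => c G - monomial (u i) 1 * g G) =
          c - fun G => monomial (u i) 1 * g G := rfl
      rw [h2, map_sub, hdc, koszulDifferential_mul, zero_sub, Pi.neg_apply] at h1
      exact (Ideal.neg_mem_iff _).1 h1
    obtain ⟨h₀, hh₀⟩ := exists_sub_koszulDifferential_mem_monomialPrime _ hgm hdg
    -- Only the degree `e` part is kept, so that the corrected cycle stays homogeneous of degree `d`
    -- and the induction hypothesis applies.
    let h : Finset (Fin n) → MvPolynomial (Fin n) K := fun G => homogeneousComponent e (h₀ G)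
    have hh : ∀ G, g G - koszulDifferential K n h G ∈ monomialPrime K (colonVariables u i) := by
      intro G
      have := homogeneousComponent_mem_monomialPrime (hh₀ G) (e + 1)
      rwa [map_sub, hgd, homogeneousComponent_koszulDifferential] at this
    have hhom : ∀ G, (koszulDifferential K n h G).IsHomogeneous (e + 1) := by
      intro G
      rw [← homogeneousComponent_koszulDifferential]
      exact homogeneousComponent_isHomogeneous _ _
    have hmon : (monomial (u i) (1 : K)).IsHomogeneous (u i).degree :=
      isHomogeneous_monomial _ rfl
    obtain ⟨h₂, hh₂, hdh₂⟩ := ih (by omega)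
      (c - fun G => monomial (u i) 1 * koszulDifferential K n h G) (fun G => by
        have h1 := (monomial_mul_mem_iff hu i _).2 (hh G)
        rw [← hprev] at h1
        have h2 := Ideal.add_mem _ (hg G) h1
        convert h2 using 1
        simp only [Pi.sub_apply]
        ring) (fun G => (hcd G).sub (he ▸ hmon.mul (hhom G))) (by
        rw [map_sub, hdc, koszulDifferential_mul, koszulDifferential_koszulDifferential]
        funext G
        simp)
    refine ⟨h₂ + fun G => monomial (u i) 1 * h G, fun G => ?_, ?_⟩
    · rw [hset, monomialSpan_insert]
      refine Ideal.add_mem _ (Ideal.mem_sup_right (hh₂ G)) (Ideal.mem_sup_left ?_)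
      exact Ideal.mul_mem_right _ _ (Ideal.mem_span_singleton_self _)
    · rw [map_add, hdh₂, koszulDifferential_mul]
      exact sub_add_cancel _ _

theorem nontrivial_koszulHomology_iff {I : Ideal (MvPolynomial (Fin n) K)} {i d : ℕ} :
    Nontrivial (KoszulHomology I i d) ↔ ¬ koszulCycles I i d ≤ koszulBoundaries I i d := by
  rw [KoszulHomology, Submodule.Quotient.nontrivial_iff, Submodule.submoduleOf, ne_eq,
    Submodule.comap_subtype_eq_top]

theorem not_nontrivial_koszulHomology {m : ℕ} {u : Fin m → (Fin n →₀ ℕ)} (hu : HasExchange u)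
    {d : ℕ} (hd : ∀ i, (u i).degree < d) (i : ℕ) :
    ¬ Nontrivial (KoszulHomology
      (monomialSpan (Set.range u) : Ideal (MvPolynomial (Fin n) K)) i d) := by
  rw [nontrivial_koszulHomology_iff, not_not]
  rintro c ⟨⟨⟨hcI, hci⟩, hcd⟩, hdc⟩
  obtain ⟨h, hh, hdh⟩ := exists_koszulDifferential_eq hu hd hcI
    (fun G => (Submodule.mem_pi.1 hcd) G (Set.mem_univ _)) hdc
  -- The primitive `h` may mix homological degrees. Its part in degree `i + 1` suffices, because the
  -- differential lowers cardinality by exactly one.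
  refine ⟨hcd, fun F => if F.card = i + 1 then h F else 0, ⟨fun F => ?_, fun F hF => if_neg hF⟩, ?_⟩
  · dsimp only
    split_ifs
    exacts [hh F, Ideal.zero_mem _]
  · funext G
    rw [koszulDifferential_apply]
    by_cases hG : G.card = i
    · rw [← hdh, koszulDifferential_apply]
      refine Finset.sum_congr rfl fun p hp => ?_
      rw [if_pos (by rw [Finset.card_insert_of_notMem (Finset.mem_compl.1 hp), hG])]
    · rw [hci G hG]
      refine Finset.sum_eq_zero fun p hp => ?_
      rw [if_neg (by rw [Finset.card_insert_of_notMem (Finset.mem_compl.1 hp)]; omega), mul_zero,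
        mul_zero]

/-- A boundary in homological degree zero has its coefficient in `(x_1, …, x_n) I`, where `x^a`
cannot occur: a generator dividing `x^a / x_p` would be a proper divisor of `x^a`. -/
theorem nontrivial_koszulHomology_zero {A : Set (Fin n →₀ ℕ)} {a : Fin n →₀ ℕ} (ha : a ∈ A)
    (hmin : ∀ b ∈ A, b ≤ a → b = a) :
    Nontrivial (KoszulHomology
      (monomialSpan A : Ideal (MvPolynomial (Fin n) K)) 0 a.degree) := by
  rw [nontrivial_koszulHomology_iff]
  intro hle
  have hmem : (Pi.single ∅ (monomial a 1) : Finset (Fin n) → MvPolynomial (Fin n) K) ∈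
      koszulCycles (monomialSpan A) 0 a.degree := by
    refine ⟨⟨⟨fun F => ?_, fun F hF => ?_⟩, ?_⟩, ?_⟩
    · by_cases h : F = ∅
      · subst h
        rw [Pi.single_eq_same, monomial_mem_monomialSpan one_ne_zero]
        exact ⟨a, ha, le_rfl⟩
      · rw [Pi.single_eq_of_ne h]
        exact Ideal.zero_mem _
    · rw [Pi.single_eq_of_ne]
      rintro rfl
      exact hF rfl
    · refine Submodule.mem_pi.2 fun F _ => ?_
      by_cases h : F = ∅
      · subst h
        rw [Pi.single_eq_same]
        exact isHomogeneous_monomial _ rfl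
      · rw [Pi.single_eq_of_ne h]
        exact Submodule.zero_mem _
    · rw [SetLike.mem_coe, LinearMap.mem_ker]
      funext G
      rw [koszulDifferential_apply]
      refine Finset.sum_eq_zero fun p _ => ?_
      rw [Pi.single_eq_of_ne (Finset.insert_ne_empty p G), mul_zero, mul_zero]
  obtain ⟨-, h, ⟨hh, -⟩, hdh⟩ := hle hmem
  have hcoeff := congrArg (coeff a) (congrFun hdh ∅)
  rw [Pi.single_eq_same, coeff_monomial, if_pos rfl, koszulDifferential_apply, coeff_sum] at hcoeff
  refine one_ne_zero (hcoeff.symm.trans (Finset.sum_eq_zero fun p _ => ?_))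
  rw [Finset.filter_empty, Finset.card_empty, pow_zero, one_mul, mul_comm, coeff_mul_X']
  split_ifs with hp
  · by_contra hne
    obtain ⟨b, hb, hba⟩ := mem_monomialSpan.1 (hh _) _ (mem_support_iff.2 hne)
    have hbeq := hmin b hb (hba.trans tsub_le_self)
    have := hba p
    rw [hbeq, Finsupp.tsub_apply, Finsupp.single_eq_same] at this
    have := Finsupp.mem_support_iff.1 hp
    omega
  · rfl

theorem regularity_eq_of_hasExchange {m : ℕ} {u : Fin m → (Fin n →₀ ℕ)} (hu : HasExchange u)
    {D : ℕ} (hD : ∀ i, (u i).degree ≤ D) {i : Fin m} (hi : (u i).degree = D)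
    (hmin : ∀ l, u l ≤ u i → u l = u i) :
    regularity (monomialSpan (Set.range u) : Ideal (MvPolynomial (Fin n) K)) =
      ((D : ℕ∞) : WithBot ℕ∞) := by
  apply le_antisymm
  · refine iSup_le fun j => iSup_le fun d => iSup_le fun hnt => ?_
    by_contra hlt
    refine not_nontrivial_koszulHomology hu (fun i => (hD i).trans_lt ?_) j hnt
    by_contra! hle
    exact hlt (by exact_mod_cast hle)
  · have hnt := nontrivial_koszulHomology_zero (K := K) (A := Set.range u) ⟨i, rfl⟩
      (by rintro _ ⟨l, rfl⟩ hl; exact hmin l hl)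
    rw [hi] at hnt
    exact le_iSup_of_le 0 (le_iSup_of_le D (le_iSup_of_le hnt le_rfl))

theorem exists_hasExchange {Λ : Type*} [LinearOrder Λ] {A : Set (Fin n →₀ ℕ)} (hA : A.Finite)
    (κ : (Fin n →₀ ℕ) → Λ) (hκ : Function.Injective κ)
    (h : ∀ a ∈ A, ∀ b ∈ A, κ b < κ a →
      ∃ p, a p < b p ∧ ∃ w ∈ A, κ w < κ a ∧ w ≤ a + Finsupp.single p 1) :
    ∃ (m : ℕ) (u : Fin m → (Fin n →₀ ℕ)), Function.Injective u ∧ Set.range u = A ∧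
      HasExchange u := by
  classical
  let s : Finset Λ := hA.toFinset.image κ
  have hs : ∀ x ∈ s, ∃ a ∈ A, κ a = x := fun x hx => by simpa [s] using hx
  have hmem : ∀ i, s.orderEmbOfFin rfl i ∈ s := fun i => Finset.orderEmbOfFin_mem s rfl i
  choose u huA hu using fun i => hs _ (hmem i)
  have hmono : ∀ i j, κ (u i) < κ (u j) ↔ i < j := fun i j => by
    rw [hu, hu, OrderEmbedding.lt_iff_lt]
  have hrange : ∀ a ∈ A, ∃ i, u i = a := by
    intro a ha
    have : κ a ∈ Set.range (s.orderEmbOfFin rfl) := by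
      rw [Finset.range_orderEmbOfFin]
      simpa [s] using ⟨a, ha, rfl⟩
    obtain ⟨i, hi⟩ := this
    exact ⟨i, hκ ((hu i).trans hi)⟩
  refine ⟨_, u, fun i j hij => ?_, ?_, ?_⟩
  · refine (s.orderEmbOfFin rfl).injective ?_
    rw [← hu, ← hu, hij]
  · exact Set.Subset.antisymm (Set.range_subset_iff.2 huA) hrange
  · intro i j hij
    obtain ⟨p, hp, w, hw, hwlt, hle⟩ := h (u i) (huA i) (u j) (huA j) ((hmono j i).2 hij)
    obtain ⟨l, rfl⟩ := hrange w hw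
    exact ⟨p, hp, l, (hmono l i).1 hwlt, hle⟩

end Koszul

/-! ### Minimal exponents on a single block -/

section Blocks

variable {α : Type*} {B : Finset α} {d k M : ℕ} {a b : α → ℕ}

/-- The restriction of `a` to `B` has maximum `M`, attained at least `d` times, and total
`k + (d - 1) M`. These are the exponents of the minimal generators of the `k`-th symbolic power of
the squarefree Veronese ideal `I_{B,d}`. -/
def IsBlockGen (B : Finset α) (d k : ℕ) (a : α → ℕ) (M : ℕ) : Prop :=
  (∀ p ∈ B, a p ≤ M) ∧ d ≤ (B.filter fun p => a p = M).card ∧ ∑ p ∈ B, a p + M = k + d * M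

theorem IsBlockGen.congr (h : IsBlockGen B d k a M) (hab : ∀ p ∈ B, b p = a p) :
    IsBlockGen B d k b M := by
  obtain ⟨h1, h2, h3⟩ := h
  refine ⟨fun p hp => hab p hp ▸ h1 p hp, ?_, ?_⟩
  · rwa [Finset.filter_congr fun p hp => by rw [hab p hp]]
  · rwa [Finset.sum_congr rfl hab]

theorem IsBlockGen.exists_eq (h : IsBlockGen B d k a M) (hd : 0 < d) : ∃ p ∈ B, a p = M := by
  obtain ⟨p, hp⟩ := Finset.card_pos.1 (hd.trans_le h.2.1)
  exact ⟨p, Finset.mem_filter.1 hp⟩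

theorem IsBlockGen.sup_eq (h : IsBlockGen B d k a M) (hd : 0 < d) : B.sup a = M := by
  obtain ⟨p, hp, rfl⟩ := h.exists_eq hd
  exact le_antisymm (Finset.sup_le h.1) (Finset.le_sup hp)

theorem IsBlockGen.mul_le_sum (h : IsBlockGen B d k a M) : d * M ≤ ∑ p ∈ B, a p := by
  calc d * M ≤ (B.filter fun p => a p = M).card * M := Nat.mul_le_mul_right _ h.2.1
    _ = ∑ p ∈ B.filter fun p => a p = M, a p := by
      rw [Finset.sum_congr rfl fun p hp => (Finset.mem_filter.1 hp).2, Finset.sum_const,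
        smul_eq_mul]
    _ ≤ _ := Finset.sum_le_sum_of_subset (Finset.filter_subset _ _)

theorem IsBlockGen.max_le (h : IsBlockGen B d k a M) : M ≤ k := by
  have := h.mul_le_sum
  have := h.2.2
  omega

theorem IsBlockGen.sum_le (h : IsBlockGen B d k a M) (hd : 0 < d) : ∑ p ∈ B, a p ≤ k * d := by
  obtain ⟨d, rfl⟩ := Nat.exists_eq_succ_of_ne_zero hd.ne'
  have h1 := Nat.mul_le_mul_left d h.max_le
  have h2 := h.2.2
  rw [Nat.succ_mul] at h2
  rw [Nat.mul_succ, mul_comm k]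
  omega

/-- The `d - 1` entries outside `F` contribute at most `(d - 1) M` to the total `k + (d - 1) M`. -/
theorem IsBlockGen.le_sum [DecidableEq α] (h : IsBlockGen B d k a M) {F : Finset α} (hF : F ⊆ B)
    (hFd : F.card + d = B.card + 1) : k ≤ ∑ p ∈ F, a p := by
  have h1 : ∑ p ∈ B \ F, a p ≤ (B \ F).card * M :=
    Finset.sum_le_card_nsmul _ _ _ fun p hp => h.1 p (Finset.mem_sdiff.1 hp).1
  have h2 := Finset.sum_sdiff (f := a) hF
  have h3 := Finset.card_sdiff_add_card_eq_card hF
  have h4 : d = (B \ F).card + 1 := by omega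
  have h5 := h.2.2
  rw [h4, add_mul] at h5
  omega

/-- If the maximum grows by `e`, at least `d` entries grow by `e` or more, yet the total grows only
by `(d - 1) e`. Hence `e = 0`, the totals agree, and so do the entries. -/
theorem IsBlockGen.eq_of_le {N : ℕ} (ha : IsBlockGen B d k a M) (hb : IsBlockGen B d k b N)
    (hd : 0 < d) (hab : ∀ p ∈ B, a p ≤ b p) : M = N ∧ ∀ p ∈ B, a p = b p := by
  have hMN : M ≤ N := by
    obtain ⟨p, hp, rfl⟩ := ha.exists_eq hd
    exact (hab p hp).trans (hb.1 p hp)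
  obtain ⟨e, rfl⟩ := exists_add_of_le hMN
  have h1 : ∑ p ∈ B, a p + d * e ≤ ∑ p ∈ B, b p := by
    calc ∑ p ∈ B, a p + d * e
        ≤ ∑ p ∈ B, a p + (B.filter fun p => b p = M + e).card * e :=
          Nat.add_le_add_left (Nat.mul_le_mul_right _ hb.2.1) _
      _ = ∑ p ∈ B, (a p + if b p = M + e then e else 0) := by
          rw [Finset.sum_add_distrib, ← Finset.sum_filter, Finset.sum_const, smul_eq_mul]
      _ ≤ _ := Finset.sum_le_sum fun p hp => by
          split_ifs with h
          · have := ha.1 p hp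
            omega
          · exact hab p hp
  have h2 := ha.2.2
  have h3 := hb.2.2
  rw [mul_add] at h3
  have he : e = 0 := by omega
  subst he
  refine ⟨rfl, (Finset.sum_eq_sum_iff_of_le hab).1 ?_⟩
  omega

theorem exists_threshold [DecidableEq α] {e : α → ℕ} (hd : 0 < d) (hdB : d ≤ B.card)
    (he : ∀ F ⊆ B, F.card + d = B.card + 1 → k ≤ ∑ p ∈ F, e p) :
    ∃ M, k + d * M ≤ ∑ p ∈ B, min (e p) M + M := by
  -- The least such `M` is the `d`-th largest entry of `e`. Truncating at it affects only `d - 1`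
  -- top entries, and the hypothesis bounds the sum of the others below by `k`.
  have hex : ∃ M, (B.filter fun p => M < e p).card < d := by
    refine ⟨B.sup e, ?_⟩
    rw [Finset.filter_false_of_mem fun p hp => (Finset.le_sup (f := e) hp).not_gt]
    exact hd
  have hle : d ≤ (B.filter fun p => Nat.find hex ≤ e p).card := by
    rcases h : Nat.find hex with _ | M
    · simpa using hdB
    · exact not_lt.1 (Nat.find_min hex (m := M) (by omega))
  have hlt := Nat.find_spec hex
  generalize Nat.find hex = M at hle hlt
  obtain ⟨D, h1, h2, h3⟩ := Finset.exists_subsuperset_card_eq (n := d - 1)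
    (s := B.filter fun p => M < e p) (t := B.filter fun p => M ≤ e p)
    (Finset.monotone_filter_right B fun p _ hp => hp.le) (by omega) (by omega)
  have hDB : D ⊆ B := h2.trans (Finset.filter_subset _ _)
  have h4 := Finset.card_sdiff_add_card_eq_card hDB
  have h5 := he (B \ D) Finset.sdiff_subset (by omega)
  refine ⟨M, ?_⟩
  have h6 : ∑ p ∈ B \ D, min (e p) M = ∑ p ∈ B \ D, e p := by
    refine Finset.sum_congr rfl fun p hp => min_eq_left ?_
    by_contra! h
    rw [Finset.mem_sdiff] at hp
    exact hp.2 (h1 (Finset.mem_filter.2 ⟨hp.1, h⟩))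
  have h7 : ∑ p ∈ D, min (e p) M = D.card * M := by
    rw [Finset.sum_congr rfl fun p hp => min_eq_right (Finset.mem_filter.1 (h2 hp)).2,
      Finset.sum_const, smul_eq_mul]
  have h8 : d = D.card + 1 := by omega
  have h9 : d * M = D.card * M + M := by rw [h8, Nat.succ_mul]
  rw [← Finset.sum_sdiff hDB, h6, h7]
  omega

theorem exists_isBlockGen_le [DecidableEq α] {e : α → ℕ} (hd : 0 < d) (hdB : d ≤ B.card)
    (he : ∀ F ⊆ B, F.card + d = B.card + 1 → k ≤ ∑ p ∈ F, e p) :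
    ∃ a M, IsBlockGen B d k a M ∧ ∀ p, a p ≤ e p := by
  have hex := exists_threshold hd hdB he
  have hspec := Nat.find_spec hex
  rcases hM : Nat.find hex with _ | M
  · rw [hM] at hspec
    refine ⟨0, 0, ⟨fun _ _ => le_rfl, ?_, ?_⟩, fun _ => Nat.zero_le _⟩
    · simpa using hdB
    · have : k = 0 := by simpa using hspec
      simp [this]
  -- Failure at `M` and success with surplus `r` at `M + 1` force at least `d + r` entries of `e` to
  -- reach `M + 1`. So `r` of the truncated maxima can be lowered by one, leaving `d` maxima and the
  -- exact total.
  · have hmin := Nat.find_min hex (m := M) (by omega)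
    rw [hM] at hspec
    rw [not_le] at hmin
    have hN : ∑ p ∈ B, min (e p) (M + 1) =
        ∑ p ∈ B, min (e p) M + (B.filter fun p => M + 1 ≤ e p).card := by
      rw [Finset.card_filter, ← Finset.sum_add_distrib]
      refine Finset.sum_congr rfl fun p _ => ?_
      split_ifs <;> omega
    have hdM : d * (M + 1) = d * M + d := Nat.mul_succ _ _
    obtain ⟨r, hr⟩ := exists_add_of_le hspec
    obtain ⟨R, hR, hRr⟩ := Finset.exists_subset_card_eq
      (s := B.filter fun p => M + 1 ≤ e p) (n := r) (by omega)
    have hRB : R ⊆ B := hR.trans (Finset.filter_subset _ _)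
    have hRe : ∀ p ∈ R, M + 1 ≤ e p := fun p hp => (Finset.mem_filter.1 (hR hp)).2
    refine ⟨fun p => min (e p) (M + 1) - if p ∈ R then 1 else 0, M + 1,
      ⟨fun p _ => (Nat.sub_le _ _).trans (min_le_right _ _), ?_, ?_⟩,
      fun p => (Nat.sub_le _ _).trans (min_le_left _ _)⟩
    · have h1 := Finset.card_sdiff_add_card_eq_card hR
      refine le_trans (by omega)
        (Finset.card_le_card (s := (B.filter fun p => M + 1 ≤ e p) \ R) fun p hp => ?_)
      rw [Finset.mem_sdiff, Finset.mem_filter] at hp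
      refine Finset.mem_filter.2 ⟨hp.1.1, ?_⟩
      dsimp only
      rw [if_neg hp.2]
      omega
    · have h2 : ∑ p ∈ B, (min (e p) (M + 1) - if p ∈ R then 1 else 0) + r =
          ∑ p ∈ B, min (e p) (M + 1) := by
        have h3 : r = ∑ p ∈ B, if p ∈ R then 1 else 0 := by
          rw [Finset.sum_ite_mem, Finset.inter_eq_right.2 hRB, Finset.sum_const, hRr, smul_eq_mul,
            mul_one]
        rw [h3, ← Finset.sum_add_distrib]
        refine Finset.sum_congr rfl fun p _ => ?_
        split_ifs with hp
        · have := hRe p hp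
          omega
        · omega
      dsimp only
      omega

/-- With more than `d` maxima, moving one unit from a maximum to `p` keeps `M` and lowers the sum of
squares. With exactly `d`, lowering all of them by one and raising `p` by one lowers the total by `d
- 1`, as the new maximum `M - 1` requires. -/
theorem IsBlockGen.exists_lower [DecidableEq α] (h : IsBlockGen B d k a M) (hd : 0 < d) {p : α}
    (hp : p ∈ B) (hpM : a p + 2 ≤ M) :
    ∃ u N, IsBlockGen B d k u N ∧ (∀ x ∉ B, u x = a x) ∧ (∀ x, u x ≤ a x + if x = p then 1 else 0) ∧
      (N < M ∨ N = M ∧ ∑ x ∈ B, u x ^ 2 < ∑ x ∈ B, a x ^ 2) := by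
  obtain ⟨h1, h2, h3⟩ := h
  rcases h2.lt_or_eq with hlt | heq
  · obtain ⟨q, hq, hqM⟩ := IsBlockGen.exists_eq ⟨h1, h2, h3⟩ hd
    have hpq : p ≠ q := by
      rintro rfl
      omega
    have hqp : q ∈ B.erase p := Finset.mem_erase.2 ⟨hpq.symm, hq⟩
    let u : α → ℕ := fun x => if x = p then a p + 1 else if x = q then M - 1 else a x
    have hup : u p = a p + 1 := if_pos rfl
    have huq : u q = M - 1 := by simp [u, hpq.symm]
    have hux : ∀ x, x ≠ p → x ≠ q → u x = a x := fun x hx hx' => by simp [u, hx, hx']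
    have hsum : ∀ f : ℕ → ℕ, ∑ x ∈ B, f (u x) + f (a p) + f M =
        ∑ x ∈ B, f (a x) + f (a p + 1) + f (M - 1) := fun f => by
      rw [← Finset.add_sum_erase B _ hp, ← Finset.add_sum_erase _ _ hqp,
        ← Finset.add_sum_erase B (fun x => f (a x)) hp,
        ← Finset.add_sum_erase _ (fun x => f (a x)) hqp, hup, huq, hqM,
        Finset.sum_congr rfl fun x hx => by
          rw [hux x (Finset.ne_of_mem_erase (Finset.mem_of_mem_erase hx))
            (Finset.ne_of_mem_erase hx)]]
      ring
    refine ⟨u, M, ⟨fun x hx => ?_, ?_, ?_⟩, fun x hx => ?_, fun x => ?_, Or.inr ⟨rfl, ?_⟩⟩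
    · by_cases hxp : x = p
      · subst hxp
        omega
      · by_cases hxq : x = q
        · subst hxq
          omega
        · rw [hux x hxp hxq]
          exact h1 x hx
    · have hmem : q ∈ B.filter fun x => a x = M := Finset.mem_filter.2 ⟨hq, hqM⟩
      refine le_trans ?_ (Finset.card_le_card
        (s := (B.filter fun x => a x = M).erase q) fun x hx => ?_)
      · rw [Finset.card_erase_of_mem hmem]
        omega
      · rw [Finset.mem_erase, Finset.mem_filter] at hx
        refine Finset.mem_filter.2 ⟨hx.2.1, ?_⟩
        rw [hux x _ hx.1, hx.2.2]
        rintro rfl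
        omega
    · have := hsum id
      simp only [id] at this
      omega
    · exact hux x (fun hxp => hx (hxp ▸ hp)) fun hxq => hx (hxq ▸ hq)
    · split_ifs with hxp
      · subst hxp
        exact hup.le
      · by_cases hxq : x = q
        · subst hxq
          omega
        · exact (hux x hxp hxq).le
    · have h4 := hsum (· ^ 2)
      obtain ⟨s, rfl⟩ := exists_add_of_le hpM
      have h5 : (a p + 1) ^ 2 + (a p + 2 + s - 1) ^ 2 < a p ^ 2 + (a p + 2 + s) ^ 2 := by
        have : a p + 2 + s - 1 = a p + 1 + s := by omega
        rw [this]
        nlinarith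
      omega
  · let u : α → ℕ := fun x =>
      if x ∈ B then min (a x + if x = p then 1 else 0) (M - 1) else a x
    have hu : ∀ x ∈ B, u x = min (a x + if x = p then 1 else 0) (M - 1) := fun x hx => if_pos hx
    refine ⟨u, M - 1, ⟨fun x hx => ?_, ?_, ?_⟩, fun x hx => if_neg hx, fun x => ?_,
      Or.inl (by omega)⟩
    · rw [hu x hx]
      exact min_le_right _ _
    · rw [heq]
      refine Finset.card_le_card fun x hx => ?_
      rw [Finset.mem_filter] at hx ⊢
      refine ⟨hx.1, ?_⟩
      rw [hu x hx.1]
      omega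
    · have h4 : ∑ x ∈ B, u x + d = ∑ x ∈ B, a x + 1 := by
        have h5 : ∑ x ∈ B, (a x + if x = p then 1 else 0) = ∑ x ∈ B, a x + 1 := by
          rw [Finset.sum_add_distrib, Finset.sum_ite_eq' B p, if_pos hp]
        rw [← h5, heq, Finset.card_filter, ← Finset.sum_add_distrib]
        refine Finset.sum_congr rfl fun x hx => ?_
        rw [hu x hx]
        have := h1 x hx
        by_cases hxp : x = p
        · subst hxp
          rw [if_pos rfl, if_neg (by omega)]
          omega
        · rw [if_neg hxp]
          split_ifs <;> omega
      obtain ⟨N, rfl⟩ : ∃ N, M = N + 1 := ⟨M - 1, by omega⟩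
      have h5 : d * (N + 1) = d * N + d := Nat.mul_succ _ _
      simp only [Nat.add_sub_cancel]
      omega
    · by_cases hx : x ∈ B
      · rw [hu x hx]
        exact min_le_left _ _
      · exact (if_neg hx).trans_le (Nat.le_add_right _ _)

theorem mem_iff_swap_mem [DecidableEq α] {p r : α} (hp : p ∈ B) (hr : r ∈ B) (x : α) :
    x ∈ B ↔ Equiv.swap p r x ∈ B := by
  by_cases hxp : x = p
  · simp [hxp, hp, hr]
  · by_cases hxr : x = r
    · simp [hxr, hp, hr]
    · rw [Equiv.swap_apply_of_ne_of_ne hxp hxr]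

theorem sum_comp_swap [DecidableEq α] {p r : α} (hp : p ∈ B) (hr : r ∈ B) (f : α → ℕ) :
    ∑ x ∈ B, f (Equiv.swap p r x) = ∑ x ∈ B, f x :=
  Finset.sum_equiv (Equiv.swap p r) (mem_iff_swap_mem hp hr) fun _ _ => rfl

theorem IsBlockGen.comp_swap [DecidableEq α] (h : IsBlockGen B d k a M) {p r : α} (hp : p ∈ B)
    (hr : r ∈ B) : IsBlockGen B d k (fun x => a (Equiv.swap p r x)) M := by
  obtain ⟨h1, h2, h3⟩ := h
  refine ⟨fun x hx => h1 _ ((mem_iff_swap_mem hp hr x).1 hx), ?_, ?_⟩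
  · rwa [Finset.card_filter, sum_comp_swap hp hr fun x => if a x = M then 1 else 0,
      ← Finset.card_filter]
  · rwa [sum_comp_swap hp hr a]

/-- This compares `t ^ 2 - (2 M - 1) t` at `x` and `y`, written without subtraction. The function
decreases strictly on integers up to `M - 1` and takes equal values at `M - 1` and `M`; its linear
part cancels when summed over blocks of equal total. -/
theorem sq_add_le {x y : ℕ} (hx : x ≤ M) (hy : y ≤ M) (hxy : x < y → M ≤ x + 1) :
    x ^ 2 + (2 * M * y + x) ≤ y ^ 2 + (2 * M * x + y) := by
  rcases lt_trichotomy x y with h | rfl | h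
  · obtain rfl : y = x + 1 := by have := hxy h; omega
    obtain rfl : M = x + 1 := by omega
    apply le_of_eq
    ring
  · exact le_rfl
  · obtain ⟨s, rfl⟩ := exists_add_of_le h.le
    obtain ⟨t, rfl⟩ := exists_add_of_le hx
    have : 1 ≤ s := by omega
    nlinarith [Nat.zero_le (s * t), Nat.mul_le_mul_left s this]

theorem eq_of_sq_add_eq {x y : ℕ} (hx : x ≤ M) (h : y < x)
    (he : x ^ 2 + (2 * M * y + x) = y ^ 2 + (2 * M * x + y)) : x = M := by
  obtain ⟨s, rfl⟩ := exists_add_of_le h.le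
  obtain ⟨t, rfl⟩ := exists_add_of_le hx
  have : 1 ≤ s := by omega
  have h1 : s + s * s + 0 = 2 * (s * s) + 2 * (s * t) := by nlinarith
  have h2 : s * 1 ≤ s * s := Nat.mul_le_mul_left s this
  have h3 : s * t = 0 := by omega
  rcases Nat.mul_eq_zero.1 h3 with h | h <;> omega

theorem sum_sq_le (ha : ∀ p ∈ B, a p ≤ M) (hb : ∀ p ∈ B, b p ≤ M)
    (hsum : ∑ p ∈ B, a p = ∑ p ∈ B, b p) (hab : ∀ p ∈ B, a p < b p → M ≤ a p + 1) :
    ∑ p ∈ B, a p ^ 2 ≤ ∑ p ∈ B, b p ^ 2 := by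
  have := Finset.sum_le_sum fun p hp => sq_add_le (ha p hp) (hb p hp) (hab p hp)
  simp only [Finset.sum_add_distrib, ← Finset.mul_sum, hsum] at this
  omega

theorem eq_of_sum_sq_eq (ha : ∀ p ∈ B, a p ≤ M) (hb : ∀ p ∈ B, b p ≤ M)
    (hsum : ∑ p ∈ B, a p = ∑ p ∈ B, b p) (hab : ∀ p ∈ B, a p < b p → M ≤ a p + 1)
    (hsq : ∑ p ∈ B, a p ^ 2 = ∑ p ∈ B, b p ^ 2) {p : α} (hp : p ∈ B) (hlt : b p < a p) :
    a p = M := by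
  refine eq_of_sq_add_eq (ha p hp) hlt ((Finset.sum_eq_sum_iff_of_le
    fun p hp => sq_add_le (ha p hp) (hb p hp) (hab p hp)).1 ?_ p hp)
  simp only [Finset.sum_add_distrib, ← Finset.mul_sum, hsum, hsq]

end Blocks

/-! ### Gluing the blocks: generators of symbolic and ordinary powers -/

section Exponents

variable {K : Type*} [Field K] {n : ℕ} {ι : Type*} [Fintype ι] {B : ι → Finset (Fin n)}
  {d : ι → ℕ} {k : ℕ}

/-- The exponents of the minimal generators of the `k`-th symbolic power of the product of the
squarefree Veronese ideals `I_{B i, d i}`. -/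
def symbolicGens (B : ι → Finset (Fin n)) (d : ι → ℕ) (k : ℕ) : Set (Fin n →₀ ℕ) :=
  {a | (∀ p, (∀ i, p ∉ B i) → a p = 0) ∧ ∀ i, ∃ M, IsBlockGen (B i) (d i) k a M}

/-- The exponents of the minimal generators of the `k`-th power of the product of the
squarefree Veronese ideals `I_{B i, d i}`. -/
def powerGens (B : ι → Finset (Fin n)) (d : ι → ℕ) (k : ℕ) : Set (Fin n →₀ ℕ) :=
  {a | (∀ p, (∀ i, p ∉ B i) → a p = 0) ∧ (∀ i, ∑ p ∈ B i, a p = k * d i) ∧ ∀ p, a p ≤ k}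

theorem exists_glue (hB : Pairwise fun i j => Disjoint (B i) (B j)) (f : ι → Fin n → ℕ) :
    ∃ a : Fin n →₀ ℕ, (∀ i, ∀ p ∈ B i, a p = f i p) ∧ ∀ p, (∀ i, p ∉ B i) → a p = 0 := by
  classical
  refine ⟨Finsupp.equivFunOnFinite.symm fun p => ∑ i, if p ∈ B i then f i p else 0,
    fun i p hp => ?_, fun p hp => ?_⟩
  · rw [Finsupp.equivFunOnFinite_symm_apply_apply, Finset.sum_eq_single i, if_pos hp]
    · intro j _ hj
      exact if_neg fun h => Finset.disjoint_left.1 (hB hj) h hp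
    · exact fun h => absurd (Finset.mem_univ i) h
  · rw [Finsupp.equivFunOnFinite_symm_apply_apply]
    exact Finset.sum_eq_zero fun i _ => if_neg (hp i)

theorem sum_univ_eq_sum_blocks (hB : Pairwise fun i j => Disjoint (B i) (B j)) {f : Fin n → ℕ}
    (hf : ∀ p, (∀ i, p ∉ B i) → f p = 0) : ∑ p, f p = ∑ i, ∑ p ∈ B i, f p := by
  classical
  rw [← Finset.sum_biUnion fun i _ j _ hij => hB hij]
  refine (Finset.sum_subset (Finset.subset_univ _) fun p _ hp => hf p fun i hi => hp ?_).symm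
  exact Finset.mem_biUnion.2 ⟨i, Finset.mem_univ i, hi⟩

theorem exists_mem_block {a : Fin n →₀ ℕ} (h0 : ∀ p, (∀ i, p ∉ B i) → a p = 0) {p : Fin n}
    (hp : a p ≠ 0) : ∃ i, p ∈ B i := by
  by_contra! h
  exact hp (h0 p h)

theorem exists_symbolicGens_le (hB : Pairwise fun i j => Disjoint (B i) (B j))
    (hd : ∀ i, 0 < d i) (hdB : ∀ i, d i ≤ (B i).card) {e : Fin n →₀ ℕ}
    (he : ∀ i, ∀ F ⊆ B i, F.card + d i = (B i).card + 1 → k ≤ ∑ p ∈ F, e p) :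
    ∃ a ∈ symbolicGens B d k, a ≤ e := by
  choose f M hf hfe using fun i => exists_isBlockGen_le (hd i) (hdB i) (he i)
  obtain ⟨a, ha, ha0⟩ := exists_glue hB f
  refine ⟨a, ⟨ha0, fun i => ⟨M i, (hf i).congr (ha i)⟩⟩, fun p => ?_⟩
  by_cases hp : ∃ i, p ∈ B i
  · obtain ⟨i, hi⟩ := hp
    exact ha i p hi ▸ hfe i p
  · rw [ha0 p (not_exists.1 hp)]
    exact Nat.zero_le _

theorem eq_of_le_of_mem_symbolicGens (hd : ∀ i, 0 < d i) {a b : Fin n →₀ ℕ}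
    (ha : a ∈ symbolicGens B d k) (hb : b ∈ symbolicGens B d k) (hab : a ≤ b) : a = b := by
  ext p
  by_cases hp : ∃ i, p ∈ B i
  · obtain ⟨i, hi⟩ := hp
    obtain ⟨M, hM⟩ := ha.2 i
    obtain ⟨N, hN⟩ := hb.2 i
    exact (hM.eq_of_le hN (hd i) fun p _ => hab p).2 p hi
  · rw [ha.1 p (not_exists.1 hp), hb.1 p (not_exists.1 hp)]

theorem finite_of_forall_le {A : Set (Fin n →₀ ℕ)} (h : ∀ a ∈ A, ∀ p, a p ≤ k) : A.Finite :=
  (Set.finite_Icc 0 (Finsupp.equivFunOnFinite.symm fun _ : Fin n => k)).subset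
    fun a ha => ⟨zero_le, fun p => h a ha p⟩

theorem apply_le_of_mem_symbolicGens {a : Fin n →₀ ℕ} (ha : a ∈ symbolicGens B d k) (p : Fin n) :
    a p ≤ k := by
  by_cases hp : ∃ i, p ∈ B i
  · obtain ⟨i, hi⟩ := hp
    obtain ⟨M, hM⟩ := ha.2 i
    exact (hM.1 p hi).trans hM.max_le
  · rw [ha.1 p (not_exists.1 hp)]
    exact Nat.zero_le _

theorem degree_eq_sum_blocks (hB : Pairwise fun i j => Disjoint (B i) (B j)) {a : Fin n →₀ ℕ}
    (h0 : ∀ p, (∀ i, p ∉ B i) → a p = 0) : a.degree = ∑ i, ∑ p ∈ B i, a p := by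
  rw [Finsupp.degree_eq_sum, sum_univ_eq_sum_blocks hB h0]

theorem degree_le_of_mem_symbolicGens (hB : Pairwise fun i j => Disjoint (B i) (B j))
    (hd : ∀ i, 0 < d i) {a : Fin n →₀ ℕ} (ha : a ∈ symbolicGens B d k) :
    a.degree ≤ ∑ i, k * d i := by
  rw [degree_eq_sum_blocks hB ha.1]
  refine Finset.sum_le_sum fun i _ => ?_
  obtain ⟨M, hM⟩ := ha.2 i
  exact hM.sum_le (hd i)

theorem degree_of_mem_powerGens (hB : Pairwise fun i j => Disjoint (B i) (B j))
    {a : Fin n →₀ ℕ} (ha : a ∈ powerGens B d k) : a.degree = ∑ i, k * d i := by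
  rw [degree_eq_sum_blocks hB ha.1]
  exact Finset.sum_congr rfl fun i _ => ha.2.1 i

theorem eq_of_le_of_mem_powerGens {a b : Fin n →₀ ℕ} (ha : a ∈ powerGens B d k)
    (hb : b ∈ powerGens B d k) (hab : a ≤ b) : a = b := by
  ext p
  by_cases hp : ∃ i, p ∈ B i
  · obtain ⟨i, hi⟩ := hp
    exact (Finset.sum_eq_sum_iff_of_le fun p _ => hab p).1
      ((ha.2.1 i).trans (hb.2.1 i).symm) p hi
  · rw [ha.1 p (not_exists.1 hp), hb.1 p (not_exists.1 hp)]

/-- The witness is `k` times the indicator of a choice of `d i` elements in each block. Its degree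
is the upper bound for the generator degrees of both powers. -/
theorem exists_mem_inter_gens (hB : Pairwise fun i j => Disjoint (B i) (B j))
    (hdB : ∀ i, d i ≤ (B i).card) (k : ℕ) :
    ∃ a, a ∈ symbolicGens B d k ∧ a ∈ powerGens B d k := by
  classical
  choose F hF hFd using fun i => Finset.exists_subset_card_eq (hdB i)
  obtain ⟨a, ha, ha0⟩ := exists_glue hB fun i p => if p ∈ F i then k else 0
  have hle : ∀ p, a p ≤ k := fun p => by
    by_cases hp : ∃ i, p ∈ B i
    · obtain ⟨i, hi⟩ := hp
      rw [ha i p hi]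
      split_ifs <;> omega
    · rw [ha0 p (not_exists.1 hp)]
      exact Nat.zero_le _
  have hsum : ∀ i, ∑ p ∈ B i, a p = k * d i := fun i => by
    rw [Finset.sum_congr rfl (ha i), Finset.sum_ite_mem, Finset.inter_eq_right.2 (hF i),
      Finset.sum_const, hFd, smul_eq_mul, mul_comm]
  refine ⟨a, ⟨ha0, fun i => ⟨k, fun p _ => hle p, ?_, ?_⟩⟩, ha0, hsum, hle⟩
  · rw [← hFd i]
    refine Finset.card_le_card fun p hp => Finset.mem_filter.2 ⟨hF i hp, ?_⟩
    rw [ha i p (hF i hp), if_pos hp]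
  · rw [hsum, mul_comm, add_comm]

/-! ### Exchange properties -/

/-- The invariant by which the generators of the symbolic powers are ordered. -/
def symbolicKey (B : ι → Finset (Fin n)) (a : Fin n →₀ ℕ) : ℕ ×ₗ (ℕ ×ₗ Lex (Fin n → ℕ)) :=
  toLex (∑ i, (B i).sup a, toLex (∑ p, a p ^ 2, toLex (a : Fin n → ℕ)))

theorem symbolicKey_injective (B : ι → Finset (Fin n)) : Function.Injective (symbolicKey B) := by
  intro a b h
  have := congrArg (fun x => ofLex (ofLex (ofLex x).2).2) h
  exact DFunLike.coe_injective this

theorem symbolicKey_lt_iff {a b : Fin n →₀ ℕ} : symbolicKey B b < symbolicKey B a ↔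
    ∑ i, (B i).sup b < ∑ i, (B i).sup a ∨ ∑ i, (B i).sup b = ∑ i, (B i).sup a ∧
      (∑ p, b p ^ 2 < ∑ p, a p ^ 2 ∨ ∑ p, b p ^ 2 = ∑ p, a p ^ 2 ∧
        toLex (b : Fin n → ℕ) < toLex (a : Fin n → ℕ)) := by
  rw [symbolicKey, symbolicKey, Prod.Lex.toLex_lt_toLex, Prod.Lex.toLex_lt_toLex]

theorem symbolicGens_exchange_lower (hB : Pairwise fun i j => Disjoint (B i) (B j))
    (hd : ∀ i, 0 < d i) {a : Fin n →₀ ℕ} (ha : a ∈ symbolicGens B d k) {i : ι} {p : Fin n}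
    (hp : p ∈ B i) (hpM : a p + 2 ≤ (B i).sup a) :
    ∃ w ∈ symbolicGens B d k, symbolicKey B w < symbolicKey B a ∧
      w ≤ a + Finsupp.single p 1 := by
  obtain ⟨M, hM⟩ := ha.2 i
  rw [hM.sup_eq (hd i)] at hpM
  obtain ⟨u, N, hu, hout, hle, hlt⟩ := hM.exists_lower (hd i) hp hpM
  let w : Fin n →₀ ℕ := Finsupp.equivFunOnFinite.symm u
  have hw : (w : Fin n → ℕ) = u := rfl
  have hne : ∀ j, j ≠ i → ∀ x ∈ B j, u x = a x := fun j hj x hx =>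
    hout x fun hxi => Finset.disjoint_left.1 (hB hj) hx hxi
  have hsup : ∀ j, j ≠ i → (B j).sup w = (B j).sup a := fun j hj =>
    Finset.sup_congr rfl (hne j hj)
  refine ⟨w, ⟨fun x hx => (hout x (hx i)).trans (ha.1 x hx), fun j => ?_⟩, ?_, fun x => ?_⟩
  · by_cases hj : j = i
    · subst hj
      exact ⟨N, hu⟩
    · obtain ⟨L, hL⟩ := ha.2 j
      exact ⟨L, hL.congr (hne j hj)⟩
  · rw [symbolicKey_lt_iff]
    have hwi : (B i).sup w = N := IsBlockGen.sup_eq hu (hd i)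
    have hai : (B i).sup a = M := hM.sup_eq (hd i)
    rcases hlt with hlt | ⟨rfl, hlt⟩
    · left
      refine Finset.sum_lt_sum (fun j _ => ?_) ⟨i, Finset.mem_univ i, by rwa [hwi, hai]⟩
      by_cases hj : j = i
      · subst hj
        rw [hwi, hai]
        exact hlt.le
      · exact (hsup j hj).le
    · right
      refine ⟨Finset.sum_congr rfl fun j _ => ?_, Or.inl ?_⟩
      · by_cases hj : j = i
        · subst hj
          rw [hwi, hai]
        · exact hsup j hj
      · rw [← Finset.sum_add_sum_compl (B i), ← Finset.sum_add_sum_compl (B i) fun x => a x ^ 2]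
        refine add_lt_add_of_lt_of_le hlt (Finset.sum_le_sum fun x hx => ?_)
        rw [hw, hout x (Finset.mem_compl.1 hx)]
  · rw [Finsupp.add_apply, Finsupp.single_apply]
    have := hle x
    simp only [eq_comm (a := p)]
    exact this

theorem exists_lt_of_sum_eq {α : Type*} {s : Finset α} {f g : α → ℕ}
    (h : ∑ x ∈ s, f x = ∑ x ∈ s, g x) {r : α} (hr : r ∈ s) (hlt : g r < f r) :
    ∃ p ∈ s, f p < g p := by
  by_contra! hle
  exact (Finset.sum_lt_sum hle ⟨r, hr, hlt⟩).ne h.symm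

/-- Swapping two entries of a block preserves the maxima and the sum of squares. Putting the smaller
value first lowers the lexicographic order, and a difference of one makes a single variable suffice.
-/
theorem symbolicGens_exchange_swap (hB : Pairwise fun i j => Disjoint (B i) (B j))
    (hd : ∀ i, 0 < d i) {a : Fin n →₀ ℕ} (ha : a ∈ symbolicGens B d k) {i : ι} {p r : Fin n}
    (hp : p ∈ B i) (hr : r ∈ B i) (hrp : r < p) (hlt : a r = a p + 1) :
    ∃ w ∈ symbolicGens B d k, symbolicKey B w < symbolicKey B a ∧
      w ≤ a + Finsupp.single p 1 := by
  let w : Fin n →₀ ℕ := Finsupp.equivFunOnFinite.symm fun x => a (Equiv.swap p r x)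
  have hw : ∀ x, w x = a (Equiv.swap p r x) := fun x => rfl
  have hne : ∀ x, x ≠ p → x ≠ r → w x = a x := fun x h h' => by
    rw [hw, Equiv.swap_apply_of_ne_of_ne h h']
  have hgen : ∀ j, ∀ M, IsBlockGen (B j) (d j) k a M → IsBlockGen (B j) (d j) k w M := by
    intro j M hM
    by_cases hj : j = i
    · subst hj
      exact hM.comp_swap hp hr
    · exact hM.congr fun x hx => hne x
        (fun h => Finset.disjoint_left.1 (hB hj) hx (h ▸ hp))
        (fun h => Finset.disjoint_left.1 (hB hj) hx (h ▸ hr))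
  refine ⟨w, ⟨fun x hx => ?_, fun j => ?_⟩, ?_, fun x => ?_⟩
  · rw [hne x (fun h => hx i (h ▸ hp)) (fun h => hx i (h ▸ hr))]
    exact ha.1 x hx
  · obtain ⟨M, hM⟩ := ha.2 j
    exact ⟨M, hgen j M hM⟩
  · rw [symbolicKey_lt_iff]
    refine Or.inr ⟨Finset.sum_congr rfl fun j _ => ?_, Or.inr ⟨?_, ?_⟩⟩
    · obtain ⟨M, hM⟩ := ha.2 j
      rw [hM.sup_eq (hd j), (hgen j M hM).sup_eq (hd j)]
    · exact Equiv.sum_comp (Equiv.swap p r) fun x => a x ^ 2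
    · refine ⟨r, fun x hx => ?_, ?_⟩
      · exact hne x (hx.trans hrp).ne hx.ne
      · change w r < a r
        rw [hw, Equiv.swap_apply_right]
        omega
  · rw [Finsupp.add_apply]
    by_cases hxp : x = p
    · subst hxp
      rw [hw, Equiv.swap_apply_left, Finsupp.single_eq_same, hlt]
    · by_cases hxr : x = r
      · subst hxr
        rw [hw, Equiv.swap_apply_right]
        omega
      · rw [hne x hxp hxr]
        exact Nat.le_add_right _ _

theorem symbolicGens_exchange (hB : Pairwise fun i j => Disjoint (B i) (B j))
    (hd : ∀ i, 0 < d i) {a b : Fin n →₀ ℕ} (ha : a ∈ symbolicGens B d k)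
    (hb : b ∈ symbolicGens B d k) (hlt : symbolicKey B b < symbolicKey B a) :
    ∃ p, a p < b p ∧ ∃ w ∈ symbolicGens B d k, symbolicKey B w < symbolicKey B a ∧
      w ≤ a + Finsupp.single p 1 := by
  by_cases hlow : ∃ i, ∃ p ∈ B i, a p < b p ∧ a p + 2 ≤ (B i).sup a
  · obtain ⟨i, p, hp, hab, hpM⟩ := hlow
    exact ⟨p, hab, symbolicGens_exchange_lower hB hd ha hp hpM⟩
  -- From here on, `b` exceeds `a` only where `a` is within one of its block maximum. This makes
  -- every maximum, and then every sum of squares, at least as large for `b`; as `b` precedes `a`,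
  -- all are equal and the lexicographic order decides.
  push Not at hlow
  choose M hM using ha.2
  choose N hN using hb.2
  have hsupa : ∀ i, (B i).sup a = M i := fun i => (hM i).sup_eq (hd i)
  have hsupb : ∀ i, (B i).sup b = N i := fun i => (hN i).sup_eq (hd i)
  have hMN : ∀ i, M i ≤ N i := by
    intro i
    by_contra! h
    have hle : ∀ p ∈ B i, b p ≤ a p := by
      intro p hp
      by_contra! hab
      have h1 := hlow i p hp hab
      have h2 := (hN i).1 p hp
      rw [hsupa] at h1
      omega
    exact h.ne ((hN i).eq_of_le (hM i) (hd i) hle).1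
  rw [symbolicKey_lt_iff] at hlt
  simp only [hsupa, hsupb] at hlt
  have hle := Finset.sum_le_sum fun i (_ : i ∈ Finset.univ) => hMN i
  obtain ⟨hsumeq, hlt⟩ := hlt.resolve_left hle.not_gt
  have hMN' : ∀ i, M i = N i := fun i =>
    (Finset.sum_eq_sum_iff_of_le fun i _ => hMN i).1 hsumeq.symm i (Finset.mem_univ i)
  have hblock : ∀ i, ∑ p ∈ B i, a p = ∑ p ∈ B i, b p := fun i => by
    have h1 := (hM i).2.2
    have h2 := (hN i).2.2
    rw [← hMN' i] at h2
    omega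
  have hbM : ∀ i, ∀ p ∈ B i, b p ≤ M i := fun i p hp => hMN' i ▸ (hN i).1 p hp
  have hgap : ∀ i, ∀ p ∈ B i, a p < b p → M i ≤ a p + 1 := fun i p hp hab => by
    have := hlow i p hp hab
    rw [hsupa] at this
    omega
  have hsq := fun i => sum_sq_le (hM i).1 (hbM i) (hblock i) (hgap i)
  have hsqa := sum_univ_eq_sum_blocks hB (f := fun p => a p ^ 2) fun p hp => by
    rw [ha.1 p hp, sq, zero_mul]
  have hsqb := sum_univ_eq_sum_blocks hB (f := fun p => b p ^ 2) fun p hp => by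
    rw [hb.1 p hp, sq, zero_mul]
  have hsqle := Finset.sum_le_sum fun i (_ : i ∈ Finset.univ) => hsq i
  rw [← hsqa, ← hsqb] at hsqle
  obtain ⟨hsqeq, hlex⟩ := hlt.resolve_left hsqle.not_gt
  have hsqeq' : ∀ i, ∑ p ∈ B i, a p ^ 2 = ∑ p ∈ B i, b p ^ 2 := fun i =>
    (Finset.sum_eq_sum_iff_of_le fun i _ => hsq i).1 (by rw [← hsqa, ← hsqb, hsqeq]) i
      (Finset.mem_univ i)
  obtain ⟨r, hrlt, hr⟩ := hlex
  change b r < a r at hr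
  replace hrlt : ∀ x < r, b x = a x := hrlt
  obtain ⟨i, hi⟩ := exists_mem_block ha.1 (p := r) (by omega)
  -- Equality of the sums of squares forces `a r = M i` at the first difference, while any `p` of
  -- the block with `a p < b p` has `a p = M i - 1`. These are the conditions for the swap.
  have har := eq_of_sum_sq_eq (hM i).1 (hbM i) (hblock i) (hgap i) (hsqeq' i) hi hr
  obtain ⟨p, hp, hab⟩ := exists_lt_of_sum_eq (hblock i) hi hr
  have hrp : r < p := by
    rcases lt_trichotomy p r with h | rfl | h
    · exact absurd (hrlt p h) hab.ne'
    · omega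
    · exact h
  have hap : a r = a p + 1 := by
    have h1 := hgap i p hp hab
    have h2 := hbM i p hp
    omega
  exact ⟨p, hab, symbolicGens_exchange_swap hB hd ha hp hi hrp hap⟩

/-- Polymatroid exchange: one unit moves from the first difference `r` to a later `p` in the same
block, and `a p < b p ≤ k` keeps the bound at `p`. -/
theorem powerGens_exchange (hB : Pairwise fun i j => Disjoint (B i) (B j)) {a b : Fin n →₀ ℕ}
    (ha : a ∈ powerGens B d k) (hb : b ∈ powerGens B d k)
    (hlt : toLex (b : Fin n → ℕ) < toLex (a : Fin n → ℕ)) :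
    ∃ p, a p < b p ∧ ∃ w ∈ powerGens B d k, toLex (w : Fin n → ℕ) < toLex (a : Fin n → ℕ) ∧
      w ≤ a + Finsupp.single p 1 := by
  obtain ⟨r, hrlt, hr⟩ := hlt
  change b r < a r at hr
  replace hrlt : ∀ x < r, b x = a x := hrlt
  obtain ⟨i, hi⟩ := exists_mem_block ha.1 (p := r) (by omega)
  obtain ⟨p, hp, hab⟩ := exists_lt_of_sum_eq ((ha.2.1 i).trans (hb.2.1 i).symm) hi hr
  have hrp : r < p := by
    rcases lt_trichotomy p r with h | rfl | h
    · exact absurd (hrlt p h) hab.ne'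
    · omega
    · exact h
  obtain ⟨c, rfl⟩ : ∃ c, a = c + Finsupp.single r 1 :=
    ⟨a - Finsupp.single r 1, (tsub_add_cancel_of_le (Finsupp.single_le_iff.2 (by omega))).symm⟩
  have hblock : ∀ j, ∑ x ∈ B j, (c + Finsupp.single p 1 : Fin n →₀ ℕ) x =
      ∑ x ∈ B j, (c + Finsupp.single r 1 : Fin n →₀ ℕ) x := by
    intro j
    simp only [Finsupp.add_apply, Finset.sum_add_distrib, Finsupp.single_apply,
      Finset.sum_ite_eq]
    congr 1
    by_cases hj : j = i
    · subst hj
      rw [if_pos hp, if_pos hi]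
    · rw [if_neg fun h => Finset.disjoint_left.1 (hB hj) h hp,
        if_neg fun h => Finset.disjoint_left.1 (hB hj) h hi]
  refine ⟨p, hab, c + Finsupp.single p 1, ⟨fun x hx => ?_, fun j => ?_, fun x => ?_⟩, ?_, ?_⟩
  · have h1 := ha.1 x hx
    rw [Finsupp.add_apply] at h1
    rw [Finsupp.add_apply, Finsupp.single_eq_of_ne (show x ≠ p from fun h => hx i (h ▸ hp))]
    omega
  · rw [hblock, ha.2.1]
  · by_cases hxp : x = p
    · subst hxp
      have h1 := hb.2.2 x
      rw [Finsupp.add_apply] at hab ⊢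
      rw [Finsupp.single_eq_same]
      omega
    · have h1 := ha.2.2 x
      rw [Finsupp.add_apply] at h1
      rw [Finsupp.add_apply, Finsupp.single_eq_of_ne hxp]
      omega
  · refine ⟨r, fun x hx => ?_, ?_⟩
    · change (c + Finsupp.single p 1 : Fin n →₀ ℕ) x = (c + Finsupp.single r 1 : Fin n →₀ ℕ) x
      rw [Finsupp.add_apply, Finsupp.add_apply, Finsupp.single_eq_of_ne (hx.trans hrp).ne,
        Finsupp.single_eq_of_ne hx.ne]
    · change (c + Finsupp.single p 1 : Fin n →₀ ℕ) r < (c + Finsupp.single r 1 : Fin n →₀ ℕ) r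
      rw [Finsupp.add_apply, Finsupp.add_apply, Finsupp.single_eq_of_ne hrp.ne,
        Finsupp.single_eq_same]
      omega
  · exact add_le_add_left (le_self_add) _

/-! ### Ordinary powers -/

open Pointwise in
theorem monomialSpan_mul (A A' : Set (Fin n →₀ ℕ)) :
    (monomialSpan A * monomialSpan A' : Ideal (MvPolynomial (Fin n) K)) =
      monomialSpan (A + A') := by
  rw [monomialSpan, monomialSpan, Ideal.span_mul_span', monomialSpan]
  congr 1
  ext f
  simp only [Set.mem_mul, Set.mem_image, Set.mem_add]
  constructor
  · rintro ⟨_, ⟨a, ha, rfl⟩, _, ⟨b, hb, rfl⟩, rfl⟩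
    exact ⟨a + b, ⟨a, ha, b, hb, rfl⟩, by rw [monomial_mul, one_mul]⟩
  · rintro ⟨_, ⟨a, ha, b, hb, rfl⟩, rfl⟩
    exact ⟨_, ⟨a, ha, rfl⟩, _, ⟨b, hb, rfl⟩, by rw [monomial_mul, one_mul]⟩

/-- The indicator of a choice of `d i` elements from each block is an exponent of a squarefree
generator. -/
theorem exists_indicator_mem_powerGens (hB : Pairwise fun i j => Disjoint (B i) (B j))
    {F : ι → Finset (Fin n)} (hF : ∀ i, F i ⊆ B i) (hFd : ∀ i, (F i).card = d i) :
    ∃ a ∈ powerGens B d 1, ∀ i, ∀ p ∈ B i, a p = if p ∈ F i then 1 else 0 := by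
  obtain ⟨a, ha, ha0⟩ := exists_glue hB fun i p => if p ∈ F i then 1 else 0
  refine ⟨a, ⟨ha0, fun i => ?_, fun p => ?_⟩, ha⟩
  · rw [Finset.sum_congr rfl (ha i), Finset.sum_ite_mem, Finset.inter_eq_right.2 (hF i),
      Finset.sum_const, hFd, smul_eq_mul, mul_comm]
  · by_cases hp : ∃ i, p ∈ B i
    · obtain ⟨i, hi⟩ := hp
      rw [ha i p hi]
      split_ifs <;> omega
    · rw [ha0 p (not_exists.1 hp)]
      exact Nat.zero_le _

theorem monomialSpan_meetSet_eq_powerGens (hB : Pairwise fun i j => Disjoint (B i) (B j)) :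
    (monomialSpan (meetSet B d) : Ideal (MvPolynomial (Fin n) K)) =
      monomialSpan (powerGens B d 1) := by
  apply monomialSpan_eq_of_forall
  · intro a ha
    choose F hF hFd using fun i => Finset.exists_subset_card_eq (ha i)
    obtain ⟨b, hb, hbF⟩ := exists_indicator_mem_powerGens hB
      (fun i => (hF i).trans (Finset.filter_subset _ _)) hFd
    refine ⟨b, hb, fun p => ?_⟩
    by_cases hp : ∃ i, p ∈ B i
    · obtain ⟨i, hi⟩ := hp
      rw [hbF i p hi]
      split_ifs with h
      · exact Nat.one_le_iff_ne_zero.2 (Finset.mem_filter.1 (hF i h)).2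
      · exact Nat.zero_le _
    · rw [hb.1 p (not_exists.1 hp)]
      exact Nat.zero_le _
  · intro a ha
    refine ⟨a, fun i => ?_, le_rfl⟩
    rw [← one_mul (d i), ← ha.2.1 i, Finset.card_filter]
    refine Finset.sum_le_sum fun p _ => ?_
    have := ha.2.2 p
    split_ifs <;> omega

open Pointwise in
theorem powerGens_succ (hB : Pairwise fun i j => Disjoint (B i) (B j)) (k : ℕ) :
    powerGens B d (k + 1) = powerGens B d k + powerGens B d 1 := by
  ext a
  rw [Set.mem_add]
  constructor
  · intro ha
    -- The set peeled off must contain every entry equal to `k + 1` and avoid every zero entry. The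
    -- total `(k + 1) * d i` allows at most `d i` of the former and forces at least `d i` nonzero
    -- entries.
    have hcard : ∀ i, ∃ F, (B i).filter (fun p => a p = k + 1) ⊆ F ∧
        F ⊆ (B i).filter (fun p => 1 ≤ a p) ∧ F.card = d i := fun i => by
      have hsum := ha.2.1 i
      refine Finset.exists_subsuperset_card_eq
        (Finset.monotone_filter_right _ fun p _ hp => by omega) ?_ ?_
      · refine le_of_mul_le_mul_left (a := k + 1) ?_ (Nat.succ_pos k)
        rw [← hsum, mul_comm, ← smul_eq_mul, ← Finset.sum_const, Finset.sum_filter]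
        exact Finset.sum_le_sum fun p _ => by split_ifs <;> omega
      · refine le_of_mul_le_mul_left (a := k + 1) ?_ (Nat.succ_pos k)
        rw [← hsum, mul_comm (k + 1) (Finset.card _), ← smul_eq_mul, ← Finset.sum_const,
          Finset.sum_filter]
        refine Finset.sum_le_sum fun p _ => ?_
        have := ha.2.2 p
        split_ifs <;> omega
    choose F hF₁ hF₂ hFd using hcard
    obtain ⟨b, hb, hbF⟩ := exists_indicator_mem_powerGens hB
      (fun i => (hF₂ i).trans (Finset.filter_subset _ _)) hFd
    have hba : b ≤ a := fun p => by
      by_cases hp : ∃ i, p ∈ B i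
      · obtain ⟨i, hi⟩ := hp
        rw [hbF i p hi]
        split_ifs with h
        · exact (Finset.mem_filter.1 (hF₂ i h)).2
        · exact Nat.zero_le _
      · rw [hb.1 p (not_exists.1 hp)]
        exact Nat.zero_le _
    obtain ⟨c, rfl⟩ := exists_add_of_le hba
    refine ⟨c, ⟨fun p hp => ?_, fun i => ?_, fun p => ?_⟩, b, hb, add_comm c b⟩
    · have := ha.1 p hp
      rw [Finsupp.add_apply] at this
      omega
    · have h1 := ha.2.1 i
      have h2 := hb.2.1 i
      simp only [Finsupp.add_apply, Finset.sum_add_distrib] at h1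
      rw [Nat.succ_mul] at h1
      omega
    · by_cases hp : ∃ i, p ∈ B i
      · obtain ⟨i, hi⟩ := hp
        have h1 := ha.2.2 p
        by_cases hpF : p ∈ F i
        · have h2 := hbF i p hi
          rw [if_pos hpF] at h2
          rw [Finsupp.add_apply] at h1
          omega
        · have h2 : ¬ (b + c) p = k + 1 := fun h => hpF (hF₁ i (Finset.mem_filter.2 ⟨hi, h⟩))
          rw [Finsupp.add_apply] at h1 h2
          omega
      · have := ha.1 p (not_exists.1 hp)
        rw [Finsupp.add_apply] at this
        omega
  · rintro ⟨b, hb, c, hc, rfl⟩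
    refine ⟨fun p hp => ?_, fun i => ?_, fun p => ?_⟩
    · rw [Finsupp.add_apply, hb.1 p hp, hc.1 p hp]
    · simp only [Finsupp.add_apply, Finset.sum_add_distrib]
      rw [hb.2.1, hc.2.1, add_mul]
    · exact add_le_add (hb.2.2 p) (hc.2.2 p)

theorem monomialSpan_meetSet_pow (hB : Pairwise fun i j => Disjoint (B i) (B j)) (k : ℕ) :
    (monomialSpan (meetSet B d) : Ideal (MvPolynomial (Fin n) K)) ^ k =
      monomialSpan (powerGens B d k) := by
  induction k with
  | zero =>
    symm
    rw [pow_zero, Ideal.one_eq_top, Ideal.eq_top_iff_one, ← C_1, ← monomial_zero',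
      monomial_mem_monomialSpan one_ne_zero]
    exact ⟨0, ⟨fun _ _ => rfl, fun i => by simp, fun _ => le_rfl⟩, le_rfl⟩
  | succ k ih =>
    rw [pow_succ, ih, powerGens_succ hB, ← monomialSpan_mul, monomialSpan_meetSet_eq_powerGens hB]

/-! ### Minimal primes, and assembly of the results -/

/-- The supports of the minimal primes of a product of squarefree Veronese ideals. -/
def minimalPrimeSupports (B : ι → Finset (Fin n)) (d : ι → ℕ) : Finset (Finset (Fin n)) :=
  open Classical in
  Finset.univ.filter fun F => ∃ i, F ⊆ B i ∧ F.card + d i = (B i).card + 1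

theorem mem_minimalPrimeSupports {F : Finset (Fin n)} : F ∈ minimalPrimeSupports B d ↔
    ∃ i, F ⊆ B i ∧ F.card + d i = (B i).card + 1 := by
  simp [minimalPrimeSupports]

theorem isAntichain_minimalPrimeSupports (hB : Pairwise fun i j => Disjoint (B i) (B j))
    (hdB : ∀ i, d i ≤ (B i).card) :
    IsAntichain (· ⊆ ·) (minimalPrimeSupports B d : Set (Finset (Fin n))) := by
  intro F hF G hG hne hle
  obtain ⟨i, hi, hFi⟩ := mem_minimalPrimeSupports.1 hF
  obtain ⟨j, hj, hGj⟩ := mem_minimalPrimeSupports.1 hG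
  have hpos : 0 < F.card := by
    have := hdB i
    omega
  obtain ⟨p, hp⟩ := Finset.card_pos.1 hpos
  obtain rfl : i = j := by
    by_contra h
    exact Finset.disjoint_left.1 (hB h) (hi hp) (hj (hle hp))
  exact hne (Finset.eq_of_subset_of_card_le hle (by omega))

/-- A block has fewer than `d i` nonzero entries exactly when `|B i| - d i + 1` of its entries
vanish. -/
theorem meetSet_eq (hdB : ∀ i, d i ≤ (B i).card) :
    meetSet B d = {a | ∀ F ∈ minimalPrimeSupports B d, ∃ p ∈ F, a p ≠ 0} := by
  ext a
  constructor
  · intro ha F hF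
    obtain ⟨i, hi, hFi⟩ := mem_minimalPrimeSupports.1 hF
    by_contra! h
    have h1 : (B i).filter (fun p => a p ≠ 0) ⊆ B i \ F := fun p hp => by
      rw [Finset.mem_filter] at hp
      exact Finset.mem_sdiff.2 ⟨hp.1, fun hpF => hp.2 (h p hpF)⟩
    have h2 := (ha i).trans (Finset.card_le_card h1)
    have h3 := Finset.card_sdiff_add_card_eq_card hi
    omega
  · intro ha i
    by_contra! h
    have h1 := Finset.card_filter_add_card_filter_not (s := B i) fun p => a p ≠ 0
    obtain ⟨F, hF, hFc⟩ := Finset.exists_subset_card_eq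
      (s := (B i).filter fun p => ¬ a p ≠ 0) (n := (B i).card + 1 - d i) (by omega)
    have h2 := hdB i
    obtain ⟨p, hp, hap⟩ := ha F (mem_minimalPrimeSupports.2
      ⟨i, hF.trans (Finset.filter_subset _ _), by omega⟩)
    exact (Finset.mem_filter.1 (hF hp)).2 hap

theorem symbolicPower_monomialSpan_meetSet (hB : Pairwise fun i j => Disjoint (B i) (B j))
    (hd : ∀ i, 0 < d i) (hdB : ∀ i, d i ≤ (B i).card) (k : ℕ) :
    symbolicPower (monomialSpan (meetSet B d) : Ideal (MvPolynomial (Fin n) K)) k =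
      monomialSpan (symbolicGens B d k) := by
  rw [meetSet_eq hdB, ← inf_monomialPrime_eq,
    symbolicPower_inf_monomialPrime (isAntichain_minimalPrimeSupports hB hdB)]
  apply monomialSpan_eq_of_forall
  · intro a ha
    exact exists_symbolicGens_le hB hd hdB fun i F hF hFd =>
      ha F (mem_minimalPrimeSupports.2 ⟨i, hF, hFd⟩)
  · intro a ha
    refine ⟨a, fun F hF => ?_, le_rfl⟩
    obtain ⟨i, hi, hFi⟩ := mem_minimalPrimeSupports.1 hF
    obtain ⟨M, hM⟩ := ha.2 i
    exact hM.le_sum hi hFi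

theorem hasLinearQuotients_and_regularity_symbolicGens
    (hB : Pairwise fun i j => Disjoint (B i) (B j)) (hd : ∀ i, 0 < d i)
    (hdB : ∀ i, d i ≤ (B i).card) (k : ℕ) :
    HasLinearQuotients (monomialSpan (symbolicGens B d k) : Ideal (MvPolynomial (Fin n) K)) ∧
      regularity (monomialSpan (symbolicGens B d k) : Ideal (MvPolynomial (Fin n) K)) =
        ((∑ i, k * d i : ℕ) : ℕ∞) := by
  obtain ⟨m, u, hinj, hrange, hu⟩ := exists_hasExchange
    (finite_of_forall_le fun a ha p => apply_le_of_mem_symbolicGens ha p)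
    (symbolicKey B) (symbolicKey_injective B)
    fun a ha b hb hlt => symbolicGens_exchange (d := d) (k := k) hB hd ha hb hlt
  have hmem : ∀ i, u i ∈ symbolicGens B d k := fun i => hrange ▸ Set.mem_range_self i
  have hanti : ∀ i j, u i ≤ u j → u i = u j := fun i j h =>
    eq_of_le_of_mem_symbolicGens hd (hmem i) (hmem j) h
  obtain ⟨w, hw, hw'⟩ := exists_mem_inter_gens hB hdB k
  rw [← hrange] at hw
  obtain ⟨i, rfl⟩ := hw
  rw [← hrange]
  exact ⟨hasLinearQuotients_of_hasExchange hu fun i j h => hinj (hanti i j h),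
    regularity_eq_of_hasExchange hu (fun j => degree_le_of_mem_symbolicGens hB hd (hmem j))
      (degree_of_mem_powerGens hB hw') fun l hl => hanti l i hl⟩

theorem regularity_powerGens (hB : Pairwise fun i j => Disjoint (B i) (B j))
    (hdB : ∀ i, d i ≤ (B i).card) (k : ℕ) :
    regularity (monomialSpan (powerGens B d k) : Ideal (MvPolynomial (Fin n) K)) =
      ((∑ i, k * d i : ℕ) : ℕ∞) := by
  obtain ⟨m, u, hinj, hrange, hu⟩ := exists_hasExchange
    (finite_of_forall_le fun a (ha : a ∈ powerGens B d k) p => ha.2.2 p)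
    (fun a => toLex (a : Fin n → ℕ)) (fun a b h => DFunLike.coe_injective (toLex.injective h))
    fun a ha b hb hlt => powerGens_exchange hB ha hb hlt
  have hmem : ∀ i, u i ∈ powerGens B d k := fun i => hrange ▸ Set.mem_range_self i
  obtain ⟨w, -, hw⟩ := exists_mem_inter_gens hB hdB k
  have hdeg := degree_of_mem_powerGens hB hw
  rw [← hrange] at hw
  obtain ⟨i, rfl⟩ := hw
  rw [← hrange]
  exact regularity_eq_of_hasExchange hu (fun j => (degree_of_mem_powerGens hB (hmem j)).le)
    hdeg fun l hl => eq_of_le_of_mem_powerGens (hmem l) (hmem i) hl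

theorem symbolicPower_bot {k : ℕ} (hk : 1 ≤ k) :
    symbolicPower (⊥ : Ideal (MvPolynomial (Fin n) K)) k = ⊥ := by
  -- The zero ideal is `P_∅`, so the general formula applies; an empty sum never reaches `k ≥ 1`.
  have hbot : (⊥ : Ideal (MvPolynomial (Fin n) K)) =
      ({∅} : Finset (Finset (Fin n))).inf (monomialPrime K) := by
    rw [Finset.inf_singleton, monomialPrime, Finset.coe_empty, Set.image_empty, Ideal.span_empty]
  rw [hbot, symbolicPower_inf_monomialPrime (by simp), ← hbot, ← monomialSpan_empty]
  congr 1
  refine Set.eq_empty_of_forall_notMem fun a ha => ?_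
  have := ha ∅ (Finset.mem_singleton_self _)
  rw [Finset.sum_empty] at this
  omega

theorem hasLinearQuotients_bot :
    HasLinearQuotients (⊥ : Ideal (MvPolynomial (Fin n) K)) := by
  have := hasLinearQuotients_of_hasExchange (K := K) (u := (Fin.elim0 : Fin 0 → Fin n →₀ ℕ))
    (fun i => i.elim0) (fun i => i.elim0)
  rwa [Set.range_eq_empty, monomialSpan_empty] at this

end Exponents

end SymbolicPowers

end

theorem theorem4p7 {K : Type*} [Field K] {n : ℕ} (I : Ideal (MvPolynomial (Fin n) K)) :
    (SymbolicPowers.IsMatchingMatroidalOfVeroneseType I ↔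
      SymbolicPowers.IsProductOfSquarefreeVeronese I) ∧
    (SymbolicPowers.IsMatchingMatroidalOfVeroneseType I →
      ∀ k : ℕ, 1 ≤ k →
        SymbolicPowers.HasLinearQuotients (SymbolicPowers.symbolicPower I k) ∧
        SymbolicPowers.regularity (SymbolicPowers.symbolicPower I k) =
          SymbolicPowers.regularity (I ^ k)) := by
  refine ⟨SymbolicPowers.isMatchingMatroidalOfVeroneseType_iff I, fun h k hk => ?_⟩
  obtain ⟨m, B, d, -, hd, hB, rfl⟩ := h.exists_meetSet
  by_cases hdB : ∀ i, d i ≤ (B i).card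
  · rw [SymbolicPowers.symbolicPower_monomialSpan_meetSet hB hd hdB,
      SymbolicPowers.monomialSpan_meetSet_pow hB]
    obtain ⟨hlin, hreg⟩ :=
      SymbolicPowers.hasLinearQuotients_and_regularity_symbolicGens (K := K) hB hd hdB k
    exact ⟨hlin, hreg.trans (SymbolicPowers.regularity_powerGens hB hdB k).symm⟩
  -- A multiplicity larger than its block makes `I` zero, and both powers vanish since `k ≥ 1`.
  · push Not at hdB
    obtain ⟨i, hi⟩ := hdB
    rw [SymbolicPowers.meetSet_eq_empty hi, SymbolicPowers.monomialSpan_empty,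
      SymbolicPowers.symbolicPower_bot hk, ← Ideal.zero_eq_bot,
      zero_pow (Nat.one_le_iff_ne_zero.1 hk)]
    exact ⟨SymbolicPowers.hasLinearQuotients_bot, rfl⟩
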